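/- Let $d\ge 1$. Let $\Omega$ be the set of measurable maps $\mathbf a$ from $\mathbb R^d$ into the symmetric positive definite $d\times d$ matrices such that $\sup_{x\in U}|\mathbf a(x)|+\sup_{x\in U}|\mathbf a(x)^{-1}|<\infty$ for every bounded $U\subset\mathbb R^d$ (operator norms). For Borel $U\subseteq\mathbb R^d$ let $\mathcal F_U$ be the $\sigma$-algebra on $\Omega$ generated by the maps $\mathbf a\mapsto\int_{\mathbb R^d} e_i\cdot\mathbf a(x)e_j\,\varphi(x)\,dx$ with $1\le i,j\le d$ and $\varphi\in C_c^\infty(U)$, and let $\mathcal F=\mathcal F_{\mathbb R^d}$. Let $\mathbb P$ be a probability measure on $(\Omega,\mathcal F)$, with expectation $\mathbb E$, such that * (stationarity) $\mathbb P[A]=\mathbb P[T_zA]$ for all $z\in\mathbb Z^d$ and $A\in\mathcal F$, where $(T_z\mathbf a)(x)=\mathbf a(x+z)$ and $T_zA=\{T_z\mathbf a:\mathbf a\in A\}$; * (mixing) for a fixed $r\in(0,1)$ and all Borel sets $U,V\subseteq\mathbb R^d$ at $\ell^\infty$-distance at least $1$, $\operatorname{Cov}[f,g]\le r\operatorname{Var}[f]^{1/2}\operatorname{Var}[g]^{1/2}$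 for all square-integrable $f,g$ that are $\mathcal F_U$-measurable and $\mathcal F_V$-measurable respectively. For $m\in\mathbb N=\{0,1,2,\dots\}$ let $\square_m=(-\tfrac12 3^m,\tfrac12 3^m)^d$. Put $$\Lambda(U)=\operatorname*{ess\,sup}_{x\in U}\ \sup_{|\xi|=1}\xi\cdot\mathbf a(x)\xi,\qquad \lambda(U)=\operatorname*{ess\,inf}_{x\in U}\ \inf_{|\xi|=1}\xi\cdot\mathbf a(x)\xi,$$ $$\mu(U,p)=\inf_{w\in H_0^1(U)}\frac1{|U|}\int_U\tfrac12\,(p+\nabla w)\cdot\mathbf a\,(p+\nabla w)\,dx\qquad(p\in\mathbb R^d),$$ where $H^1_0(U)$ is the closure of $C_c^\infty(U)$ in $H^1(U)$. Suppose that $\mathbb E[\Lambda(\square_0)]$ and $\mathbb E[\lambda(\square_0)^{-1}]$ are finite. Then $\mu(\square_m,p)$ is integrable for all $m\in\mathbb N$ and $p\in\mathbb R^d$, the limit $$\bar\mu(p):=\lim_{m\to\infty}\mathbb E[\mu(\square_m,p)]=\inf_{m\in\mathbb N}\mathbb E[\mu(\square_m,p)]$$ exists for every $p$, and there is a unique symmetric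 matrix $\bar{\mathbf a}\in\mathbb R^{d\times d}$ (the homogenized matrix) with $\bar\mu(p)=\tfrac12\,p\cdot\bar{\mathbf a}p$ for all $p\in\mathbb R^d$. Moreover $\bar{\mathbf a}$ is positive definite and $$\mathbb E[\lambda(\square_0)^{-1}]^{-1}\,\mathsf{Id}\ \le\ \bar{\mathbf a}\ \le\ \mathbb E[\Lambda(\square_0)]\,\mathsf{Id},$$ where $A\le B$ means $p\cdot(B-A)p\ge0$ for every $p\in\mathbb R^d$. -/

import Mathlib

open MeasureTheory Filter Topology ProbabilityTheory
open scoped ENNReal ContDiff Matrix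

noncomputable section

namespace StochHom

/-- Euclidean space of dimension `d`, with its Euclidean norm and Lebesgue measure. -/
abbrev E (d : ℕ) : Type := EuclideanSpace ℝ (Fin d)

/-- The quadratic form `ξ · A ξ` of a real square matrix. -/
def quad {d : ℕ} (A : Matrix (Fin d) (Fin d) ℝ) (ξ : E d) : ℝ :=
  ξ.ofLp ⬝ᵥ (A *ᵥ ξ.ofLp)

/-- The Euclidean operator norm of a matrix. -/
def opNorm {d : ℕ} (A : Matrix (Fin d) (Fin d) ℝ) : ℝ :=
  ‖Matrix.toEuclideanCLM (n := Fin d) (𝕜 := ℝ) A‖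

/-- The order `A ≤ B` between matrices: `p · (B - A) p ≥ 0` for every vector `p`. -/
def LoewnerLE {d : ℕ} (A B : Matrix (Fin d) (Fin d) ℝ) : Prop :=
  ∀ p : E d, 0 ≤ quad (B - A) p

/-- A coefficient field: a measurable map from Euclidean space to the (symmetric) positive
definite matrices which is bounded, together with its inverse, on every bounded set. -/
structure CoeffField (d : ℕ) where
  toFun : E d → Matrix (Fin d) (Fin d) ℝ
  measurable_entry : ∀ i j, Measurable fun x => toFun x i j
  posDef : ∀ x, (toFun x).PosDef
  locallyBounded : ∀ U : Set (E d), Bornology.IsBounded U →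
    ∃ C : ℝ, ∀ x ∈ U, opNorm (toFun x) + opNorm (toFun x)⁻¹ ≤ C

/-- `φ ∈ C_c^∞(U)`. -/
structure IsTest {d : ℕ} (U : Set (E d)) (φ : E d → ℝ) : Prop where
  contDiff : ContDiff ℝ ∞ φ
  hasCompactSupport : HasCompactSupport φ
  tsupport_subset : tsupport φ ⊆ U

/-- The σ-algebra on coefficient fields generated by the maps `a ↦ ∫ e_i · a(x) e_j φ(x) dx`
with `φ ∈ C_c^∞(U)`. -/
@[reducible] def sigmaField {d : ℕ} (U : Set (E d)) : MeasurableSpace (CoeffField d) :=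
  ⨆ (i : Fin d) (j : Fin d) (φ : E d → ℝ) (_ : IsTest U φ),
    MeasurableSpace.comap (fun a => ∫ x, a.toFun x i j * φ x) (borel ℝ)

instance instMeasurableSpaceCoeffField (d : ℕ) : MeasurableSpace (CoeffField d) :=
  sigmaField Set.univ

/-- The shift `(T_y a)(x) = a(x + y)`. -/
def shift {d : ℕ} (y : E d) (a : CoeffField d) : CoeffField d where
  toFun x := a.toFun (x + y)
  measurable_entry i j := (a.measurable_entry i j).comp (measurable_id.add_const y)
  posDef x := a.posDef (x + y)
  locallyBounded U hU := by
    obtain ⟨C, hC⟩ := a.locallyBounded ((fun x => x + y) '' U)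
      ((LipschitzWith.id.add (LipschitzWith.const y)).isBounded_image hU)
    exact ⟨C, fun x hx => hC _ ⟨x, hx, rfl⟩⟩

/-- An integer vector as a point of Euclidean space. -/
def latticePoint {d : ℕ} (z : Fin d → ℤ) : E d := WithLp.toLp 2 fun i => (z i : ℝ)

/-- Stationarity with respect to integer translations. -/
def IsStationary {d : ℕ} (P : Measure (CoeffField d)) : Prop :=
  ∀ (z : Fin d → ℤ) (A : Set (CoeffField d)), MeasurableSet A →
    P A = P (shift (latticePoint z) '' A)

/-- The `ℓ^∞` distance between two sets (it is `∞` if one of them is empty). -/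
def linftyDist {d : ℕ} (U V : Set (E d)) : ℝ≥0∞ :=
  ⨅ u ∈ U, ⨅ v ∈ V, edist u.ofLp v.ofLp

/-- The maximal correlation of the σ-algebras of two Borel sets at `ℓ^∞` distance at least `1`
is at most `r`. -/
def MaxCorrelationLE {d : ℕ} (P : Measure (CoeffField d)) (r : ℝ) : Prop :=
  ∀ U V : Set (E d), MeasurableSet U → MeasurableSet V → 1 ≤ linftyDist U V →
    ∀ f g : CoeffField d → ℝ,
      Measurable[sigmaField U] f → Measurable[sigmaField V] g →
      MemLp f 2 P → MemLp g 2 P →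
      cov[f, g; P] ≤ r * (√Var[f; P] * √Var[g; P])

/-- The triadic cube `(-3^n/2, 3^n/2)^d`. -/
def cube (d n : ℕ) : Set (E d) :=
  {x | ∀ i, -(1 / 2 * (3 : ℝ) ^ n) < x i ∧ x i < 1 / 2 * (3 : ℝ) ^ n}

/-- `Λ(U)`: the essential supremum over `x ∈ U` of the maximum of `ξ · a(x) ξ`, `|ξ| = 1`. -/
def ellipUpper {d : ℕ} (a : CoeffField d) (U : Set (E d)) : ℝ :=
  essSup (fun x => ⨆ ξ : Metric.sphere (0 : E d) 1, quad (a.toFun x) ξ) (volume.restrict U)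

/-- `λ(U)`: the essential infimum over `x ∈ U` of the minimum of `ξ · a(x) ξ`, `|ξ| = 1`. -/
def ellipLower {d : ℕ} (a : CoeffField d) (U : Set (E d)) : ℝ :=
  essInf (fun x => ⨅ ξ : Metric.sphere (0 : E d) 1, quad (a.toFun x) ξ) (volume.restrict U)

/-- `w ∈ H^1(U)` with weak gradient `G`. -/
structure HasWeakGradient {d : ℕ} (U : Set (E d)) (w : E d → ℝ) (G : E d → E d) : Prop where
  memLp_fun : MemLp w 2 (volume.restrict U)
  memLp_grad : MemLp G 2 (volume.restrict U)
  integral_eq : ∀ φ : E d → ℝ, IsTest U φ → ∀ i : Fin d,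
    ∫ x in U, w x * gradient φ x i = - ∫ x in U, G x i * φ x

/-- `w ∈ H^1_0(U)` with weak gradient `G`: `w` belongs to the closure of `C_c^∞(U)` in the norm
of `H^1(U)`. -/
def HasWeakGradientZero {d : ℕ} (U : Set (E d)) (w : E d → ℝ) (G : E d → E d) : Prop :=
  HasWeakGradient U w G ∧ ∀ ε : ℝ≥0∞, 0 < ε → ∃ φ : E d → ℝ, IsTest U φ ∧
    eLpNorm (fun x => w x - φ x) 2 (volume.restrict U) +
      eLpNorm (fun x => G x - gradient φ x) 2 (volume.restrict U) < ε

/-- The subadditive energy `μ(U, p)`: the infimum over `w ∈ H^1_0(U)` of the mean over `U` of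
`(p + ∇w) · a (p + ∇w) / 2`. -/
def mu {d : ℕ} (a : CoeffField d) (U : Set (E d)) (p : E d) : ℝ :=
  sInf {e : ℝ | ∃ (w : E d → ℝ) (G : E d → E d), HasWeakGradientZero U w G ∧
    e = ⨍ x in U, 1 / 2 * quad (a.toFun x) (p + G x)}

/-- `E[μ(□_m, p)]`. -/
def meanMu {d : ℕ} (P : Measure (CoeffField d)) (m : ℕ) (p : E d) : ℝ :=
  ∫ a, mu a (cube d m) p ∂P

/-- `abar` is the homogenized matrix: it is symmetric, and `p · abar p / 2` is the limit of
`E[μ(□_m, p)]` as `m → ∞`, for every `p`. -/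
def IsHomogenizedMatrix {d : ℕ} (P : Measure (CoeffField d))
    (abar : Matrix (Fin d) (Fin d) ℝ) : Prop :=
  abar.IsSymm ∧ ∀ p : E d, Tendsto (fun m => meanMu P m p) atTop (𝓝 (1 / 2 * quad abar p))

end StochHom

end

noncomputable section

namespace StochHom

/-! The energy `mu` is subadditive over triadic cubes. Near-minimizers on the `3 ^ d` subcubes of
`cube d (m + 1)`, translated into place, add up to a competitor on the large cube
(`mu_cube_succ_le`). The subcube centres are integer vectors, so by stationarity every subcube has
the same expected energy. Hence the means `meanMu P m p` decrease in `m`; being nonnegative, they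
converge to their infimum.

For a fixed field, `mu a U` is 2-homogeneous and satisfies the parallelogram law, inherited from the
integrand by combining near-minimizers (`mu_smul`, `mu_parallelogram`). Both identities survive
expectation and limit, and a bounded homogeneous functional with the parallelogram law comes from a
symmetric matrix (`exists_symm_matrix_of_parallelogram`), which polarization makes unique.

The upper bound comes from the zero competitor on the unit cube. For the lower bound, Young's
inequality on a unit cube gives `½ V·aV ≥ s p·V - s²|p|²/(2λ)` with one constant `s` for all cubes.
Averaged over the unit cubes of `cube d m`, the linear term for `V = p + ∇φ` is `s|p|²` whatever `φ`
is, and in expectation the last term involves only `E[λ⁻¹]` (`le_energy_cube`, `le_meanMu`). Taking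
`s = E[λ⁻¹]⁻¹` yields the bound, hence positive definiteness.

Integrability also needs measurability of `mu`: density reduces the infimum over `H^1_0` to one over
a countable family of test functions, and each of their energies is a limit of expressions in the
generators of the σ-algebra. -/

variable {d : ℕ}

/-! ### Quadratic forms of matrices -/

/-- The continuous linear map attached to a matrix. -/
abbrev matCLM (A : Matrix (Fin d) (Fin d) ℝ) : E d →L[ℝ] E d :=
  Matrix.toEuclideanCLM (n := Fin d) (𝕜 := ℝ) A

theorem quad_eq_inner (A : Matrix (Fin d) (Fin d) ℝ) (ξ : E d) :
    quad A ξ = inner ℝ ξ (matCLM A ξ) := by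
  rw [Matrix.inner_toEuclideanCLM, quad]

theorem quad_eq_sum (A : Matrix (Fin d) (Fin d) ℝ) (ξ : E d) :
    quad A ξ = ∑ i, ∑ j, A i j * (ξ i * ξ j) := by
  simp only [quad, dotProduct, Matrix.mulVec, Finset.mul_sum]
  exact Finset.sum_congr rfl fun i _ => Finset.sum_congr rfl fun j _ => by ring

theorem quad_smul (A : Matrix (Fin d) (Fin d) ℝ) (t : ℝ) (ξ : E d) :
    quad A (t • ξ) = t ^ 2 * quad A ξ := by
  simp only [quad_eq_inner, map_smul, inner_smul_left, inner_smul_right]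
  simp; ring

@[simp] theorem quad_zero (A : Matrix (Fin d) (Fin d) ℝ) : quad A 0 = 0 := by
  simp [quad_eq_inner]

theorem quad_add_add_quad_sub (A : Matrix (Fin d) (Fin d) ℝ) (ξ η : E d) :
    quad A (ξ + η) + quad A (ξ - η) = 2 * quad A ξ + 2 * quad A η := by
  simp only [quad_eq_inner, map_add, map_sub, inner_add_left, inner_add_right, inner_sub_left,
    inner_sub_right]
  ring

theorem quad_pos {A : Matrix (Fin d) (Fin d) ℝ} (hA : A.PosDef) {ξ : E d} (hξ : ξ ≠ 0) :
    0 < quad A ξ := by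
  have h := hA.dotProduct_mulVec_pos (x := ξ.ofLp) (by simpa using hξ)
  simpa [quad] using h

theorem quad_nonneg {A : Matrix (Fin d) (Fin d) ℝ} (hA : A.PosDef) (ξ : E d) :
    0 ≤ quad A ξ := by
  rcases eq_or_ne ξ 0 with rfl | h
  · simp
  · exact (quad_pos hA h).le

/-- Young's inequality: expand `quad A (δ • ξ - η) ≥ 0` and divide by `δ`. -/
theorem quad_add_le {A : Matrix (Fin d) (Fin d) ℝ} (hA : A.PosDef) (ξ η : E d) {δ : ℝ}
    (hδ : 0 < δ) :
    quad A (ξ + η) ≤ (1 + δ) * quad A ξ + (1 + δ⁻¹) * quad A η := by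
  have h := quad_nonneg hA (δ • ξ - η)
  have h1 : quad A (δ • ξ - η) =
      δ ^ 2 * quad A ξ + quad A η - δ * (quad A (ξ + η) - quad A ξ - quad A η) := by
    simp only [quad_eq_inner, map_add, map_sub, map_smul, inner_add_left, inner_add_right,
      inner_sub_left, inner_sub_right, inner_smul_left, inner_smul_right]
    simp; ring
  rw [h1] at h
  have h2 : 0 ≤ δ⁻¹ *
      (δ ^ 2 * quad A ξ + quad A η - δ * (quad A (ξ + η) - quad A ξ - quad A η)) := by positivity
  have h3 : δ⁻¹ *
      (δ ^ 2 * quad A ξ + quad A η - δ * (quad A (ξ + η) - quad A ξ - quad A η)) =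
      δ * quad A ξ + δ⁻¹ * quad A η - (quad A (ξ + η) - quad A ξ - quad A η) := by
    field_simp
  linarith

theorem abs_quad_le (A : Matrix (Fin d) (Fin d) ℝ) (ξ : E d) :
    |quad A ξ| ≤ opNorm A * ‖ξ‖ ^ 2 := by
  rw [quad_eq_inner]
  calc |inner ℝ ξ (matCLM A ξ)| ≤ ‖ξ‖ * ‖matCLM A ξ‖ := abs_real_inner_le_norm _ _
    _ ≤ ‖ξ‖ * (opNorm A * ‖ξ‖) := by gcongr; exact (matCLM A).le_opNorm ξ
    _ = _ := by ring

theorem opNorm_nonneg (A : Matrix (Fin d) (Fin d) ℝ) : 0 ≤ opNorm A := norm_nonneg _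

theorem abs_entry_le_opNorm (A : Matrix (Fin d) (Fin d) ℝ) (i j : Fin d) :
    |A i j| ≤ opNorm A := by
  have h : A i j = inner ℝ (EuclideanSpace.single i (1 : ℝ))
      (matCLM A (EuclideanSpace.single j (1 : ℝ))) := by
    rw [Matrix.inner_toEuclideanCLM]
    simp
  rw [h]
  refine (abs_real_inner_le_norm _ _).trans ?_
  have := (matCLM A).le_opNorm (EuclideanSpace.single j (1 : ℝ))
  simpa [opNorm] using this

/-- Turns a bound on the inverse into coercivity. With `η = A⁻¹ξ`, expanding `quad A (C • ξ - η) ≥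
0` and using `η·Aη = η·ξ ≤ C|ξ|²` leaves `C (C quad A ξ - |ξ|²) ≥ 0`. -/
theorem norm_sq_le_mul_quad {A : Matrix (Fin d) (Fin d) ℝ} (hA : A.PosDef) {C : ℝ} (hC : 0 < C)
    (h : opNorm A⁻¹ ≤ C) (ξ : E d) : ‖ξ‖ ^ 2 ≤ C * quad A ξ := by
  have hdet : IsUnit A.det := (Matrix.isUnit_iff_isUnit_det A).1 hA.isUnit
  set η : E d := matCLM A⁻¹ ξ
  have hη : matCLM A η = ξ := by
    have : matCLM A η = matCLM (A * A⁻¹) ξ := by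
      simp [η, matCLM, map_mul]
    rw [this, Matrix.mul_nonsing_inv A hdet]
    simp [matCLM]
  have hη' : inner ℝ η (matCLM A ξ) = ‖ξ‖ ^ 2 := by
    have hs : inner ℝ η (matCLM A ξ) = inner ℝ ξ (matCLM A η) := by
      have ht : Aᵀ = A := by simpa using hA.isHermitian.eq
      rw [Matrix.inner_toEuclideanCLM, Matrix.inner_toEuclideanCLM, Matrix.dotProduct_mulVec,
        ← Matrix.mulVec_transpose, ht, dotProduct_comm]
    rw [hs, hη, real_inner_self_eq_norm_sq]
  have hq : inner ℝ η ξ ≤ C * ‖ξ‖ ^ 2 := by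
    have h1 := abs_quad_le A⁻¹ ξ
    rw [quad_eq_inner, real_inner_comm] at h1
    exact (le_abs_self _).trans (h1.trans (by gcongr))
  have h0 := quad_nonneg hA (C • ξ - η)
  rw [quad_eq_inner] at h0
  simp only [map_sub, map_smul, inner_sub_left, inner_sub_right, inner_smul_left,
    inner_smul_right, hη, hη', real_inner_self_eq_norm_sq, ← quad_eq_inner] at h0
  simp only [conj_trivial] at h0
  have h1 : 0 ≤ C * (C * quad A ξ - ‖ξ‖ ^ 2) := by nlinarith
  have := nonneg_of_mul_nonneg_right h1 hC
  linarith

theorem measurable_quad {A : E d → Matrix (Fin d) (Fin d) ℝ}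
    (hA : ∀ i j, Measurable fun x => A x i j) (μ : Measure (E d)) {V : E d → E d}
    (hV : AEStronglyMeasurable V μ) : AEStronglyMeasurable (fun x => quad (A x) (V x)) μ := by
  simp only [quad_eq_sum]
  have hc : ∀ i, AEStronglyMeasurable (fun x => V x i) μ := fun i =>
    (EuclideanSpace.proj (𝕜 := ℝ) i).continuous.comp_aestronglyMeasurable hV
  refine Finset.aestronglyMeasurable_fun_sum _ fun i _ =>
    Finset.aestronglyMeasurable_fun_sum _ fun j _ => ?_
  exact (hA i j).aestronglyMeasurable.mul ((hc i).mul (hc j))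

theorem quad_single_add_single {A : Matrix (Fin d) (Fin d) ℝ} (hA : A.IsSymm) (i j : Fin d) :
    quad A (EuclideanSpace.single i 1 + EuclideanSpace.single j 1) =
      quad A (EuclideanSpace.single i 1) + quad A (EuclideanSpace.single j 1) + 2 * A i j := by
  have h : ∀ k l, inner ℝ (EuclideanSpace.single k (1 : ℝ))
      (matCLM A (EuclideanSpace.single l (1 : ℝ))) = A k l := fun k l => by
    rw [Matrix.inner_toEuclideanCLM]
    simp
  simp only [quad_eq_inner, map_add, inner_add_left, inner_add_right, h]
  rw [hA.apply i j]
  ring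

theorem ext_of_quad_eq {A B : Matrix (Fin d) (Fin d) ℝ} (hA : A.IsSymm) (hB : B.IsSymm)
    (h : ∀ p, quad A p = quad B p) : A = B := by
  ext i j
  have h1 := quad_single_add_single hA i j
  have h2 := quad_single_add_single hB i j
  simp only [h] at h1
  linarith

/-- A bounded homogeneous functional satisfying the parallelogram law is a quadratic form. -/
theorem exists_symm_matrix_of_parallelogram (Q : E d → ℝ) {C : ℝ}
    (hsmul : ∀ (t : ℝ) p, Q (t • p) = t ^ 2 * Q p)
    (hpar : ∀ p q, Q (p + q) + Q (p - q) = 2 * Q p + 2 * Q q)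
    (hbd : ∀ p, |Q p| ≤ C * ‖p‖ ^ 2) :
    ∃ A : Matrix (Fin d) (Fin d) ℝ, A.IsSymm ∧ ∀ p, quad A p = Q p := by
  have hneg : ∀ p, Q (-p) = Q p := fun p => by simpa using hsmul (-1) p
  have hQ0 : Q 0 = 0 := by simpa using hsmul 0 0
  let B : E d → E d → ℝ := fun p q => (Q (p + q) - Q (p - q)) / 4
  have hsymm : ∀ p q, B p q = B q p := fun p q => by
    simp only [B]
    rw [add_comm p q, ← neg_sub q p, hneg]
  have hB0 : ∀ q, B 0 q = 0 := fun q => by simp [B, hneg]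
  have hmid : ∀ x y q, B (x + y) q + B (x - y) q = 2 * B x q := fun x y q => by
    have h1 := hpar (x + q) y
    have h2 := hpar (x - q) y
    simp only [B]
    rw [show x + y + q = x + q + y by abel, show x + y - q = x - q + y by abel,
      show x - y + q = x + q - y by abel, show x - y - q = x - q - y by abel]
    linarith
  -- Jordan–von Neumann: `hmid` at the pair of half sum and half difference, and at two equal half
  -- sums, evaluates `2 B(½(x+y), q)` in two ways.
  have hadd : ∀ x y q, B (x + y) q = B x q + B y q := fun x y q => by
    have h1 := hmid x y q
    have h2 := hmid ((1 / 2 : ℝ) • (x + y)) ((1 / 2 : ℝ) • (x + y)) q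
    have h3 := hmid ((1 / 2 : ℝ) • (x + y)) ((1 / 2 : ℝ) • (x - y)) q
    rw [sub_self, hB0, ← add_smul] at h2
    rw [← smul_add, ← smul_sub, show x + y + (x - y) = (2 : ℝ) • x by rw [two_smul]; abel,
      show x + y - (x - y) = (2 : ℝ) • y by rw [two_smul]; abel, smul_smul, smul_smul] at h3
    norm_num at h2 h3
    linarith
  let f : E d → (E d →+ ℝ) := fun q =>
    { toFun := fun x => B x q, map_zero' := hB0 q, map_add' := fun x y => hadd x y q }
  -- The quadratic bound on `Q` bounds `B(·, q)` near zero; an additive map bounded near zero is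
  -- continuous, hence real-linear.
  have hcont : ∀ q, Continuous (f q) := fun q => by
    refine AddMonoidHom.continuous_of_isBounded_nhds_zero (f q)
      (Metric.ball_mem_nhds (0 : E d) one_pos) ?_
    have hC : 0 ≤ |C| := abs_nonneg C
    refine (Metric.isBounded_closedBall (x := (0 : ℝ)) (r := |C| * (1 + ‖q‖) ^ 2)).subset ?_
    rintro _ ⟨x, hx, rfl⟩
    have hx1 : ‖x‖ ≤ 1 := by simpa using (mem_ball_zero_iff.1 hx).le
    have hb : ∀ y : E d, ‖y‖ ≤ ‖x‖ + ‖q‖ → |Q y| ≤ |C| * (1 + ‖q‖) ^ 2 := fun y hy => by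
      refine (hbd y).trans ?_
      have : ‖y‖ ≤ 1 + ‖q‖ := by linarith
      calc C * ‖y‖ ^ 2 ≤ |C| * ‖y‖ ^ 2 := by gcongr; exact le_abs_self C
        _ ≤ _ := by gcongr
    have h1 := abs_le.1 (hb _ (norm_add_le x q))
    have h2 := abs_le.1 (hb _ (norm_sub_le x q))
    rw [mem_closedBall_zero_iff, Real.norm_eq_abs]
    change |(Q (x + q) - Q (x - q)) / 4| ≤ _
    rw [abs_le]
    constructor <;> linarith [h1.1, h1.2, h2.1, h2.2]
  have hBs : ∀ (t : ℝ) x q, B (t • x) q = t * B x q := fun t x q => by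
    exact ((f q).toRealLinearMap (hcont q)).map_smul t x
  have hsum : ∀ (s : Finset (Fin d)) (g : Fin d → E d) q,
      B (∑ i ∈ s, g i) q = ∑ i ∈ s, B (g i) q := fun s g q => map_sum (f q) g s
  let e : Fin d → E d := fun i => EuclideanSpace.single i 1
  refine ⟨Matrix.of fun i j => B (e i) (e j), ?_, fun p => ?_⟩
  · ext i j
    simp [hsymm]
  · have hp : p = ∑ i, p i • e i := by
      ext k
      simp [e, Pi.single_apply]
    have hQ : Q p = B p p := by
      simp only [B]
      rw [sub_self, hQ0, ← two_smul ℝ p, hsmul]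
      ring
    have hexp : ∀ q, B p q = ∑ i, p i * B (e i) q := fun q => by
      conv_lhs => rw [hp, hsum]
      exact Finset.sum_congr rfl fun i _ => hBs _ _ _
    have : B p p = ∑ i, ∑ j, B (e i) (e j) * (p i * p j) := by
      rw [hexp]
      refine Finset.sum_congr rfl fun i _ => ?_
      rw [hsymm, hexp, Finset.mul_sum]
      refine Finset.sum_congr rfl fun j _ => ?_
      rw [hsymm]
      ring
    rw [hQ, this, quad_eq_sum]
    rfl

/-! ### Triadic cubes and their subdivision -/

theorem cube_eq_preimage (d n : ℕ) :
    cube d n = WithLp.ofLp ⁻¹'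
      (Set.univ.pi fun _ : Fin d => Set.Ioo (-(1 / 2 * (3 : ℝ) ^ n)) (1 / 2 * (3 : ℝ) ^ n)) := by
  ext x
  simp [cube, Set.mem_pi]

theorem isOpen_cube (d n : ℕ) : IsOpen (cube d n) := by
  rw [cube_eq_preimage]
  exact (isOpen_set_pi Set.finite_univ fun _ _ => isOpen_Ioo).preimage
    (PiLp.continuous_ofLp 2 _)

theorem measurableSet_cube (d n : ℕ) : MeasurableSet (cube d n) := (isOpen_cube d n).measurableSet

theorem isBounded_cube (d n : ℕ) : Bornology.IsBounded (cube d n) := by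
  rw [cube_eq_preimage]
  exact (PiLp.antilipschitzWith_ofLp 2 _).isBounded_preimage
    (Bornology.IsBounded.pi fun _ => Metric.isBounded_Ioo _ _)

theorem volume_cube (d n : ℕ) : volume (cube d n) = ENNReal.ofReal ((3 : ℝ) ^ n) ^ d := by
  rw [cube_eq_preimage, (PiLp.volume_preserving_ofLp (Fin d)).measure_preimage
    (MeasurableSet.univ_pi fun _ => measurableSet_Ioo).nullMeasurableSet, volume_pi_pi]
  simp only [Real.volume_Ioo, Finset.prod_const, Finset.card_univ, Fintype.card_fin]
  ring_nf

theorem volume_real_cube (d n : ℕ) : volume.real (cube d n) = ((3 : ℝ) ^ n) ^ d := by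
  rw [Measure.real, volume_cube, ENNReal.toReal_pow, ENNReal.toReal_ofReal (by positivity)]

theorem volume_cube_lt_top (d n : ℕ) : volume (cube d n) < ⊤ := by
  rw [volume_cube]
  exact ENNReal.pow_lt_top ENNReal.ofReal_lt_top

theorem volume_cube_pos (d n : ℕ) : 0 < volume (cube d n) := by
  rw [volume_cube]
  exact ENNReal.pow_pos (by positivity) _

/-- The integer coordinates of the centres of the `3 ^ d` triadic subcubes of `cube d (m + 1)`. -/
def subIndex (m : ℕ) (k : Fin d → Fin 3) : Fin d → ℤ := fun i => 3 ^ m * ((k i : ℕ) - 1)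

/-- The centres of the `3 ^ d` triadic subcubes of `cube d (m + 1)`. -/
def subCenter (m : ℕ) (k : Fin d → Fin 3) : E d := latticePoint (subIndex m k)

theorem subCenter_apply (m : ℕ) (k : Fin d → Fin 3) (i : Fin d) :
    subCenter m k i = 3 ^ m * (((k i : ℕ) : ℝ) - 1) := by
  simp [subCenter, subIndex, latticePoint]

theorem add_subCenter_mem_cube {m : ℕ} (k : Fin d → Fin 3) {x : E d} (hx : x ∈ cube d m) :
    x + subCenter m k ∈ cube d (m + 1) := by
  intro i
  have h := hx i
  have h3 : (0 : ℝ) < 3 ^ m := by positivity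
  simp only [PiLp.add_apply, subCenter_apply, pow_succ]
  generalize k i = j
  fin_cases j <;> norm_num <;> constructor <;> linarith [h.1, h.2]

/-- The triadic subcubes of `cube d (m + 1)`. -/
def subcube (m : ℕ) (k : Fin d → Fin 3) : Set (E d) := (fun x => x + subCenter m k) '' cube d m

theorem subcube_eq_preimage (m : ℕ) (k : Fin d → Fin 3) :
    subcube m k = (fun x => x + -subCenter m k) ⁻¹' cube d m := by
  ext x
  simp [subcube, ← sub_eq_add_neg]

theorem measurableSet_subcube (m : ℕ) (k : Fin d → Fin 3) : MeasurableSet (subcube m k) := by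
  rw [subcube_eq_preimage]
  exact measurable_id.add_const _ (measurableSet_cube d m)

theorem volume_subcube (m : ℕ) (k : Fin d → Fin 3) :
    volume (subcube m k) = volume (cube d m) := by
  rw [subcube_eq_preimage, measure_preimage_add_right]

theorem subcube_subset (m : ℕ) (k : Fin d → Fin 3) : subcube m k ⊆ cube d (m + 1) := by
  rintro _ ⟨x, hx, rfl⟩
  exact add_subCenter_mem_cube k hx

/-- Distinct centres differ by at least `3 ^ m` in some coordinate, while coordinates of two points
of the open cube differ by less. This gives disjointness of the subcubes and separates the glued
competitors. -/
theorem eq_of_add_subCenter_eq {m : ℕ} {k l : Fin d → Fin 3} {x y : E d} (hx : x ∈ cube d m)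
    (hy : y ∈ cube d m) (h : x + subCenter m k = y + subCenter m l) : k = l := by
  ext i
  have h1 := congrArg (fun z : E d => z i) h
  simp only [PiLp.add_apply, subCenter_apply] at h1
  have h3 : (0 : ℝ) < 3 ^ m := by positivity
  have hxi := hx i
  have hyi := hy i
  by_contra hne
  rcases lt_or_gt_of_ne hne with hlt | hlt
  · have h4 : ((k i : ℕ) : ℝ) + 1 ≤ ((l i : ℕ) : ℝ) := by exact_mod_cast hlt
    nlinarith [hxi.1, hxi.2, hyi.1, hyi.2]
  · have h4 : ((l i : ℕ) : ℝ) + 1 ≤ ((k i : ℕ) : ℝ) := by exact_mod_cast hlt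
    nlinarith [hxi.1, hxi.2, hyi.1, hyi.2]

theorem pairwise_disjoint_subcube (m : ℕ) :
    Pairwise (Function.onFun Disjoint (subcube (d := d) m)) := by
  intro k l hkl
  rw [Function.onFun, Set.disjoint_left]
  rintro _ ⟨x, hx, rfl⟩ ⟨y, hy, hxy⟩
  exact hkl (eq_of_add_subCenter_eq hx hy hxy.symm)

/-- The missing faces are null by counting volume: `3 ^ d` disjoint copies already fill the measure
of the large cube. -/
theorem iUnion_subcube_ae_eq (m : ℕ) :
    (⋃ k : Fin d → Fin 3, subcube m k) =ᵐ[volume] cube d (m + 1) := by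
  refine ae_eq_of_subset_of_measure_ge (Set.iUnion_subset (subcube_subset m)) ?_
    (MeasurableSet.iUnion (measurableSet_subcube m)).nullMeasurableSet (volume_cube_lt_top _ _).ne
  rw [measure_iUnion (pairwise_disjoint_subcube m) (measurableSet_subcube m)]
  simp only [volume_subcube, tsum_fintype, Finset.sum_const, Finset.card_univ, volume_cube,
    Fintype.card_pi, Fintype.card_fin, Finset.prod_const, nsmul_eq_mul]
  rw [pow_succ, ENNReal.ofReal_mul (by positivity), mul_pow, mul_comm]
  simp

theorem setIntegral_cube_succ {m : ℕ} {F : E d → ℝ} (hF : IntegrableOn F (cube d (m + 1))) :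
    ∫ x in cube d (m + 1), F x =
      ∑ k : Fin d → Fin 3, ∫ x in cube d m, F (x + subCenter m k) := by
  rw [← setIntegral_congr_set (iUnion_subcube_ae_eq m),
    integral_iUnion_fintype (measurableSet_subcube m) (pairwise_disjoint_subcube m)
      fun k => hF.mono_set (subcube_subset m k)]
  refine Finset.sum_congr rfl fun k _ => ?_
  exact (measurePreserving_add_right volume (subCenter m k)).setIntegral_image_emb
    (measurableEmbedding_addRight _) _ _

theorem setAverage_cube_succ {m : ℕ} {F : E d → ℝ} (hF : IntegrableOn F (cube d (m + 1))) :
    ⨍ x in cube d (m + 1), F x =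
      ((3 : ℝ) ^ d)⁻¹ * ∑ k : Fin d → Fin 3, ⨍ x in cube d m, F (x + subCenter m k) := by
  simp only [setAverage_eq, volume_real_cube, smul_eq_mul, setIntegral_cube_succ hF,
    ← Finset.mul_sum]
  rw [pow_succ, mul_pow, mul_inv]
  ring

/-! ### Test functions -/

theorem gradient_apply_eq (φ : E d → ℝ) (x : E d) (i : Fin d) :
    gradient φ x i = fderiv ℝ φ x (EuclideanSpace.single i 1) := by
  have h := inner_gradient_right (𝕜 := ℝ) (f := φ) (x := EuclideanSpace.single i (1 : ℝ)) (y := x)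
  rw [EuclideanSpace.inner_single_left, map_one, one_mul] at h
  exact h

namespace IsTest

variable {U V : Set (E d)} {φ ψ : E d → ℝ}

theorem differentiable (h : IsTest U φ) : Differentiable ℝ φ :=
  h.contDiff.differentiable (by simp)

theorem contDiff_gradient (h : IsTest U φ) : ContDiff ℝ ∞ (gradient φ) := by
  have : ContDiff ℝ ∞ (fderiv ℝ φ) := h.contDiff.fderiv_right (by simp)
  exact (InnerProductSpace.toDual ℝ (E d)).symm.toContinuousLinearEquiv.contDiff.comp this

theorem support_gradient_subset (φ : E d → ℝ) : Function.support (gradient φ) ⊆ tsupport φ := by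
  intro x hx
  refine support_fderiv_subset ℝ (f := φ) ?_
  rw [Function.mem_support] at hx ⊢
  intro h
  exact hx (by simp [gradient, h])

theorem hasCompactSupport_gradient (h : IsTest U φ) : HasCompactSupport (gradient φ) :=
  h.hasCompactSupport.mono' (support_gradient_subset φ)

theorem memLp_gradient (h : IsTest U φ) (μ : Measure (E d)) [IsFiniteMeasureOnCompacts μ] :
    MemLp (gradient φ) 2 μ :=
  h.contDiff_gradient.continuous.memLp_of_hasCompactSupport h.hasCompactSupport_gradient

theorem zero (U : Set (E d)) : IsTest U (0 : E d → ℝ) where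
  contDiff := contDiff_const
  hasCompactSupport := HasCompactSupport.zero
  tsupport_subset := by simp [tsupport]

theorem add (hφ : IsTest U φ) (hψ : IsTest U ψ) : IsTest U (φ + ψ) where
  contDiff := hφ.contDiff.add hψ.contDiff
  hasCompactSupport := hφ.hasCompactSupport.add hψ.hasCompactSupport
  tsupport_subset := (tsupport_add φ ψ).trans
    (Set.union_subset hφ.tsupport_subset hψ.tsupport_subset)

theorem smul (hφ : IsTest U φ) (t : ℝ) : IsTest U (t • φ) where
  contDiff := contDiff_const.smul hφ.contDiff
  hasCompactSupport := hφ.hasCompactSupport.smul_left (f := fun _ => t)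
  tsupport_subset := (closure_mono (Function.support_const_smul_subset t φ)).trans
    hφ.tsupport_subset

theorem mono (hφ : IsTest U φ) (h : U ⊆ V) : IsTest V φ :=
  ⟨hφ.contDiff, hφ.hasCompactSupport, hφ.tsupport_subset.trans h⟩

theorem sum {ι : Type*} (s : Finset ι) {φ : ι → E d → ℝ} (h : ∀ i ∈ s, IsTest U (φ i)) :
    IsTest U (∑ i ∈ s, φ i) := by
  classical
  induction s using Finset.induction_on with
  | empty => exact zero U
  | insert i s hi ih =>
    rw [Finset.sum_insert hi]
    exact (h i (Finset.mem_insert_self i s)).add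
      (ih fun j hj => h j (Finset.mem_insert_of_mem hj))

theorem comp_sub (hφ : IsTest U φ) (c : E d) :
    IsTest ((fun x => x + c) '' U) (fun x => φ (x - c)) := by
  have hts : tsupport (fun x => φ (x - c)) ⊆ (fun x => x + c) '' tsupport φ := by
    refine closure_minimal (fun x hx => ⟨x - c, subset_tsupport φ hx, by simp⟩) ?_
    exact (Homeomorph.addRight c).isClosedMap _ (isClosed_tsupport φ)
  refine ⟨hφ.contDiff.comp (contDiff_id.sub contDiff_const), ?_,
    hts.trans (Set.image_mono hφ.tsupport_subset)⟩
  exact hφ.hasCompactSupport.comp_homeomorph (Homeomorph.subRight c)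

end IsTest

theorem gradient_add {φ ψ : E d → ℝ} (hφ : Differentiable ℝ φ) (hψ : Differentiable ℝ ψ)
    (x : E d) : gradient (φ + ψ) x = gradient φ x + gradient ψ x := by
  simp only [gradient]
  rw [fderiv_add (hφ x) (hψ x), map_add]

theorem gradient_smul {φ : E d → ℝ} (hφ : Differentiable ℝ φ) (t : ℝ) (x : E d) :
    gradient (t • φ) x = t • gradient φ x := by
  simp only [gradient]
  rw [fderiv_const_smul (hφ x)]
  simp

theorem gradient_comp_sub (φ : E d → ℝ) (c x : E d) :
    gradient (fun y => φ (y - c)) x = gradient φ (x - c) := by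
  simp only [gradient]
  rw [fderiv_comp_sub]

/-- Integration by parts against the constant `1`. It makes the mean of `p + ∇φ` independent of `φ`.
-/
theorem integral_gradient_eq_zero {U : Set (E d)} {φ : E d → ℝ} (hφ : IsTest U φ) (i : Fin d) :
    ∫ x in U, gradient φ x i = 0 := by
  rw [setIntegral_eq_integral_of_forall_compl_eq_zero fun x hx => ?_]
  · have hi : Integrable (fun x => fderiv ℝ φ x (EuclideanSpace.single i 1)) := by
      simp only [← gradient_apply_eq]
      exact ((EuclideanSpace.proj (𝕜 := ℝ) i).continuous.comp
        hφ.contDiff_gradient.continuous).integrable_of_hasCompactSupport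
        (hφ.hasCompactSupport_gradient.comp_left (g := fun v : E d => v i) rfl)
    have h := integral_mul_fderiv_eq_neg_fderiv_mul_of_integrable (μ := (volume : Measure (E d)))
      (f := fun _ => (1 : ℝ)) (g := φ) (v := EuclideanSpace.single i (1 : ℝ)) (by simp)
      (by simpa using hi)
      (by simpa using hφ.contDiff.continuous.integrable_of_hasCompactSupport hφ.hasCompactSupport)
      (fun _ _ => differentiableAt_const _) (fun x _ => hφ.differentiable x)
    simpa [gradient_apply_eq] using h
  · have : gradient φ x = 0 := by
      by_contra h
      exact hx (hφ.tsupport_subset (IsTest.support_gradient_subset φ h))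
    simp [this]

theorem IsTest.hasWeakGradientZero {U : Set (E d)} {φ : E d → ℝ} (hφ : IsTest U φ) :
    HasWeakGradientZero U φ (gradient φ) := by
  refine ⟨⟨hφ.contDiff.continuous.memLp_of_hasCompactSupport hφ.hasCompactSupport,
    hφ.memLp_gradient _, fun ψ hψ i => ?_⟩, fun ε hε => ⟨φ, hφ, by simpa using hε⟩⟩
  have hc : ∀ {χ : E d → ℝ}, IsTest U χ →
      Continuous fun x => fderiv ℝ χ x (EuclideanSpace.single i 1) := fun {χ} hχ => by
    simp only [← gradient_apply_eq]
    exact (EuclideanSpace.proj (𝕜 := ℝ) i).continuous.comp hχ.contDiff_gradient.continuous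
  rw [setIntegral_eq_integral_of_forall_compl_eq_zero fun x hx => ?_,
    setIntegral_eq_integral_of_forall_compl_eq_zero fun x hx => ?_]
  · simp only [gradient_apply_eq]
    refine integral_mul_fderiv_eq_neg_fderiv_mul_of_integrable ?_ ?_ ?_
      (fun x _ => hφ.differentiable x) (fun x _ => hψ.differentiable x)
    · exact ((hc hφ).mul hψ.contDiff.continuous).integrable_of_hasCompactSupport
        hψ.hasCompactSupport.mul_left
    · exact (hφ.contDiff.continuous.mul (hc hψ)).integrable_of_hasCompactSupport
        hφ.hasCompactSupport.mul_right
    · exact (hφ.contDiff.continuous.mul hψ.contDiff.continuous).integrable_of_hasCompactSupport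
        hφ.hasCompactSupport.mul_right
  · rw [image_eq_zero_of_notMem_tsupport fun h => hx (hψ.tsupport_subset h), mul_zero]
  · rw [image_eq_zero_of_notMem_tsupport fun h => hx (hφ.tsupport_subset h), zero_mul]

/-! ### The energy functional -/

/-- The mean over `U` of `V · a V / 2`. -/
def energy (a : CoeffField d) (U : Set (E d)) (V : E d → E d) : ℝ :=
  ⨍ x in U, 1 / 2 * quad (a.toFun x) (V x)

theorem energy_nonneg (a : CoeffField d) (U : Set (E d)) (V : E d → E d) :
    0 ≤ energy a U V := by
  rw [energy, setAverage_eq, smul_eq_mul]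
  exact mul_nonneg (by positivity)
    (integral_nonneg fun x => mul_nonneg (by norm_num) (quad_nonneg (a.posDef x) _))

theorem CoeffField.exists_bound (a : CoeffField d) {U : Set (E d)} (hU : Bornology.IsBounded U) :
    ∃ C : ℝ, 0 < C ∧ ∀ x ∈ U, opNorm (a.toFun x) ≤ C ∧ opNorm (a.toFun x)⁻¹ ≤ C := by
  obtain ⟨C, hC⟩ := a.locallyBounded U hU
  refine ⟨max C 1, by positivity, fun x hx => ?_⟩
  have h := hC x hx
  have h1 := opNorm_nonneg (a.toFun x)
  have h2 := opNorm_nonneg (a.toFun x)⁻¹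
  exact ⟨le_trans (by linarith) (le_max_left _ _), le_trans (by linarith) (le_max_left _ _)⟩

theorem integral_norm_sq_eq {ν : Measure (E d)} {W : E d → E d} (hW : MemLp W 2 ν) :
    ∫ x, ‖W x‖ ^ 2 ∂ν = (eLpNorm W 2 ν).toReal ^ 2 := by
  have h0 : 0 ≤ ∫ x, ‖W x‖ ^ 2 ∂ν := integral_nonneg fun x => by positivity
  rw [hW.eLpNorm_eq_integral_rpow_norm (by simp) (by simp)]
  simp only [ENNReal.toReal_ofNat, Real.rpow_ofNat]
  rw [ENNReal.toReal_ofReal (by positivity), ← Real.rpow_natCast, ← Real.rpow_mul h0]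
  norm_num

theorem integrableOn_quad (a : CoeffField d) {U : Set (E d)}
    (hU : Bornology.IsBounded U) (hUm : MeasurableSet U) {V : E d → E d}
    (hV : MemLp V 2 (volume.restrict U)) :
    IntegrableOn (fun x => quad (a.toFun x) (V x)) U := by
  obtain ⟨C, -, hC⟩ := a.exists_bound hU
  refine ((memLp_two_iff_integrable_sq_norm hV.1).1 hV |>.const_mul C).mono'
    (measurable_quad a.measurable_entry _ hV.1) ?_
  filter_upwards [ae_restrict_mem hUm] with x hx
  rw [Real.norm_eq_abs]
  exact (abs_quad_le _ _).trans (by gcongr; exact (hC x hx).1)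

theorem energy_add_le (a : CoeffField d) {U : Set (E d)}
    (hU : Bornology.IsBounded U) (hUm : MeasurableSet U) {V W : E d → E d}
    (hV : MemLp V 2 (volume.restrict U))
    (hW : MemLp W 2 (volume.restrict U)) {δ : ℝ} (hδ : 0 < δ) :
    energy a U (fun x => V x + W x) ≤ (1 + δ) * energy a U V + (1 + δ⁻¹) * energy a U W := by
  simp only [energy, setAverage_eq, smul_eq_mul]
  have hiV := (integrableOn_quad a hU hUm hV).const_mul (1 / 2)
  have hiW := (integrableOn_quad a hU hUm hW).const_mul (1 / 2)
  rw [mul_left_comm, mul_left_comm (1 + δ⁻¹), ← mul_add]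
  refine mul_le_mul_of_nonneg_left ?_ (by positivity)
  rw [← integral_const_mul, ← integral_const_mul (1 + δ⁻¹),
    ← integral_add (hiV.const_mul _) (hiW.const_mul _)]
  refine integral_mono ((integrableOn_quad a hU hUm (hV.add hW)).const_mul (1 / 2))
    ((hiV.const_mul _).add (hiW.const_mul _)) fun x => ?_
  have := quad_add_le (a.posDef x) (V x) (W x) hδ
  dsimp only
  linarith

theorem exists_energy_le_mul_sq (a : CoeffField d) {U : Set (E d)}
    (hU : Bornology.IsBounded U) (hUm : MeasurableSet U) :
    ∃ K : ℝ, 0 < K ∧ ∀ W : E d → E d, MemLp W 2 (volume.restrict U) →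
      energy a U W ≤ K * (eLpNorm W 2 (volume.restrict U)).toReal ^ 2 := by
  obtain ⟨C, hC0, hC⟩ := a.exists_bound hU
  have hv : 0 ≤ (volume.real U)⁻¹ := by positivity
  refine ⟨(volume.real U)⁻¹ * C + 1, by positivity, fun W hW => ?_⟩
  rw [← integral_norm_sq_eq hW, energy, setAverage_eq, smul_eq_mul]
  have hsq := (memLp_two_iff_integrable_sq_norm hW.1).1 hW
  have h0 : 0 ≤ ∫ x in U, ‖W x‖ ^ 2 := integral_nonneg fun x => by positivity
  have h1 : ∫ x in U, 1 / 2 * quad (a.toFun x) (W x) ≤ C * ∫ x in U, ‖W x‖ ^ 2 := by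
    rw [← integral_const_mul]
    refine setIntegral_mono_on ((integrableOn_quad a hU hUm hW).const_mul _)
      (hsq.const_mul C) hUm fun x hx => ?_
    have h2 := (le_abs_self _).trans (abs_quad_le (a.toFun x) (W x))
    have h3 : opNorm (a.toFun x) * ‖W x‖ ^ 2 ≤ C * ‖W x‖ ^ 2 := by gcongr; exact (hC x hx).1
    have h4 := quad_nonneg (a.posDef x) (W x)
    linarith
  calc _ ≤ (volume.real U)⁻¹ * (C * ∫ x in U, ‖W x‖ ^ 2) := by gcongr
    _ ≤ _ := by rw [add_mul, mul_assoc]; linarith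

/-- Continuity of the energy in `L²`, in the one direction needed: replacing a competitor by an
`L²`-close one costs at most `η`. -/
theorem exists_energy_le_add (a : CoeffField d) {U : Set (E d)}
    (hU : Bornology.IsBounded U) (hUm : MeasurableSet U) {V : E d → E d}
    (hV : MemLp V 2 (volume.restrict U)) {η : ℝ}
    (hη : 0 < η) :
    ∃ ε : ℝ, 0 < ε ∧ ∀ W : E d → E d, MemLp W 2 (volume.restrict U) →
      eLpNorm (fun x => V x - W x) 2 (volume.restrict U) ≤ ENNReal.ofReal ε →
      energy a U W ≤ energy a U V + η := by
  obtain ⟨K, hK, hKb⟩ := exists_energy_le_mul_sq a hU hUm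
  have he := energy_nonneg a U V
  -- `δ` makes the Young excess at most `η / 2`; the `+ 1` covers zero energy. Then `ε` makes the
  -- remaining term equal to `η / 2`.
  set δ : ℝ := η / 2 / (energy a U V + 1) with hδdef
  have hδ : 0 < δ := by positivity
  have hδe : δ * energy a U V ≤ η / 2 := by
    rw [hδdef, div_mul_eq_mul_div, div_le_iff₀ (by positivity)]
    nlinarith
  set ε : ℝ := √(η / 2 / ((1 + δ⁻¹) * K))
  have hε : 0 < ε := Real.sqrt_pos.2 (by positivity)
  have hε2 : (1 + δ⁻¹) * (K * ε ^ 2) = η / 2 := by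
    rw [Real.sq_sqrt (by positivity)]
    field_simp
  refine ⟨ε, hε, fun W hW hVW => ?_⟩
  have hd : MemLp (fun x => W x - V x) 2 (volume.restrict U) := hW.sub hV
  have h1 := energy_add_le a hU hUm hV hd hδ
  have h2 := hKb _ hd
  have h3 : (eLpNorm (fun x => W x - V x) 2 (volume.restrict U)).toReal ≤ ε := by
    refine ENNReal.toReal_le_of_le_ofReal hε.le ?_
    have : eLpNorm (fun x => W x - V x) 2 (volume.restrict U) =
        eLpNorm (fun x => V x - W x) 2 (volume.restrict U) := eLpNorm_sub_comm W V _ _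
    rwa [this]
  simp only [add_sub_cancel] at h1
  have h4 : energy a U (fun x => W x - V x) ≤ K * ε ^ 2 := h2.trans (by gcongr)
  have h5 : (1 + δ⁻¹) * energy a U (fun x => W x - V x) ≤ η / 2 := by
    rw [← hε2]
    gcongr
  linarith

/-! ### The subadditive energy as an infimum over test functions -/

theorem mu_le {U : Set (E d)} (a : CoeffField d) (p : E d) {φ : E d → ℝ} (hφ : IsTest U φ) :
    mu a U p ≤ energy a U (fun x => p + gradient φ x) := by
  refine csInf_le ⟨0, ?_⟩ ⟨φ, gradient φ, hφ.hasWeakGradientZero, rfl⟩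
  rintro _ ⟨w, G, -, rfl⟩
  exact energy_nonneg a U _

theorem mu_nonneg (a : CoeffField d) (U : Set (E d)) (p : E d) : 0 ≤ mu a U p := by
  refine Real.sInf_nonneg ?_
  rintro _ ⟨w, G, -, rfl⟩
  exact energy_nonneg a U _

theorem mu_le_energy_const (a : CoeffField d) (U : Set (E d)) (p : E d) : mu a U p ≤ energy a U
    (fun _ => p) := by
  have h := mu_le a p (IsTest.zero U)
  have h0 : ∀ x : E d, gradient (0 : E d → ℝ) x = 0 := fun x => by simp [gradient]
  simpa only [h0, add_zero] using h

theorem memLp_const_add {U : Set (E d)} (hU : Bornology.IsBounded U) {W : E d → E d} (p : E d)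
    (hW : MemLp W 2 (volume.restrict U)) :
    MemLp (fun x => p + W x) 2 (volume.restrict U) := by
  have : IsFiniteMeasure (volume.restrict U) := ⟨by simpa using hU.measure_lt_top⟩
  exact (memLp_const p).add hW

/-- Density of `C_c^∞(U)` in `H^1_0(U)` and `L²` continuity of the energy: only smooth competitors
need to be tested. -/
theorem le_mu (a : CoeffField d) {U : Set (E d)}
    (hU : Bornology.IsBounded U) (hUm : MeasurableSet U) (p : E d) {c : ℝ}
    (h : ∀ φ, IsTest U φ → c ≤ energy a U (fun x => p + gradient φ x)) : c ≤ mu a U p := by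
  refine le_csInf ⟨_, 0, _, (IsTest.zero U).hasWeakGradientZero, rfl⟩ ?_
  rintro _ ⟨w, G, hw, rfl⟩
  refine le_of_forall_pos_le_add fun η hη => ?_
  obtain ⟨ε, hε, hεb⟩ :=
    exists_energy_le_add a hU hUm (memLp_const_add hU p hw.1.memLp_grad) hη
  obtain ⟨φ, hφ, hφε⟩ := hw.2 (ENNReal.ofReal ε) (by simpa using hε)
  refine (h φ hφ).trans (hεb _ (memLp_const_add hU p (hφ.memLp_gradient _)) ?_)
  simp only [add_sub_add_left_eq_sub]
  exact le_add_self.trans hφε.le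

theorem exists_energy_lt (a : CoeffField d) {U : Set (E d)}
    (hU : Bornology.IsBounded U) (hUm : MeasurableSet U) (p : E d) {c : ℝ} (h : mu a U p < c) :
    ∃ φ, IsTest U φ ∧ energy a U (fun x => p + gradient φ x) < c := by
  by_contra! hc
  exact absurd (le_mu a hU hUm p hc) (not_le.2 h)

theorem mu_smul_le (a : CoeffField d) {U : Set (E d)}
    (hU : Bornology.IsBounded U) (hUm : MeasurableSet U) (t : ℝ) (p : E d) : mu a U
    (t • p) ≤ t ^ 2 * mu a U p := by
  rcases eq_or_ne t 0 with rfl | ht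
  · have h := mu_le_energy_const a U (0 : E d)
    simpa [energy] using h
  · have ht2 : 0 < t ^ 2 := by positivity
    rw [mul_comm, ← div_le_iff₀ ht2]
    refine le_mu a hU hUm p fun φ hφ => ?_
    rw [div_le_iff₀ ht2]
    refine (mu_le a (t • p) (hφ.smul t)).trans_eq ?_
    simp only [gradient_smul hφ.differentiable, ← smul_add, energy, quad_smul, setAverage_eq,
      smul_eq_mul]
    rw [mul_assoc, ← integral_mul_const]
    congr 2
    ext x
    ring

/-- Scaling competitors gives one inequality; the other is that inequality for `t⁻¹`. -/
theorem mu_smul (a : CoeffField d) {U : Set (E d)}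
    (hU : Bornology.IsBounded U) (hUm : MeasurableSet U) (t : ℝ) (p : E d) : mu a U
    (t • p) = t ^ 2 * mu a U p := by
  rcases eq_or_ne t 0 with rfl | ht
  · refine le_antisymm (mu_smul_le a hU hUm 0 p) ?_
    simpa using mu_nonneg a U 0
  · refine le_antisymm (mu_smul_le a hU hUm t p) ?_
    have h := mu_smul_le a hU hUm t⁻¹ (t • p)
    rw [inv_smul_smul₀ ht] at h
    have ht2 : 0 < t ^ 2 := by positivity
    calc t ^ 2 * mu a U p ≤ t ^ 2 * (t⁻¹ ^ 2 * mu a U (t • p)) := by gcongr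
      _ = _ := by field_simp

theorem energy_add_add_energy_sub (a : CoeffField d) {U : Set (E d)}
    (hU : Bornology.IsBounded U) (hUm : MeasurableSet U) {V W : E d → E d}
    (hV : MemLp V 2 (volume.restrict U))
    (hW : MemLp W 2 (volume.restrict U)) :
    energy a U (fun x => V x + W x) + energy a U (fun x => V x - W x) =
      2 * energy a U V + 2 * energy a U W := by
  have hi : ∀ {Z : E d → E d}, MemLp Z 2 (volume.restrict U) →
      IntegrableOn (fun x => 1 / 2 * quad (a.toFun x) (Z x)) U := fun hZ =>
    (integrableOn_quad a hU hUm hZ).const_mul _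
  have hadd : IntegrableOn (fun x => 1 / 2 * quad (a.toFun x) (V x + W x)) U := hi (hV.add hW)
  have hsub : IntegrableOn (fun x => 1 / 2 * quad (a.toFun x) (V x - W x)) U := hi (hV.sub hW)
  simp only [energy, setAverage_eq, smul_eq_mul]
  rw [← mul_add, mul_left_comm, mul_left_comm 2 _ (∫ x in U, _ * quad _ (W x)), ← mul_add,
    ← integral_const_mul, ← integral_const_mul, ← integral_add hadd hsub,
    ← integral_add ((hi hV).const_mul 2) ((hi hW).const_mul 2)]
  congr 2
  ext x
  linarith [quad_add_add_quad_sub (a.toFun x) (V x) (W x)]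

/-- If `φ` and `ψ` nearly minimize for `p` and `q`, then `φ ± ψ` compete for `p ± q`, and the energy
itself obeys the parallelogram law. -/
theorem mu_parallelogram_le (a : CoeffField d) {U : Set (E d)}
    (hU : Bornology.IsBounded U) (hUm : MeasurableSet U) (p q : E d) :
    mu a U (p + q) + mu a U (p - q) ≤ 2 * mu a U p + 2 * mu a U q := by
  refine le_of_forall_pos_le_add fun η hη => ?_
  obtain ⟨φ, hφ, hφe⟩ := exists_energy_lt a hU hUm p (lt_add_of_pos_right _ (by positivity :
    0 < η / 4))
  obtain ⟨ψ, hψ, hψe⟩ := exists_energy_lt a hU hUm q (lt_add_of_pos_right _ (by positivity :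
    0 < η / 4))
  have h1 := mu_le a (p + q) (hφ.add hψ)
  have h2 := mu_le a (p - q) (hφ.add (hψ.smul (-1)))
  have h3 := energy_add_add_energy_sub a hU hUm
    (memLp_const_add hU p (hφ.memLp_gradient _)) (memLp_const_add hU q (hψ.memLp_gradient _))
  simp only [gradient_add hφ.differentiable hψ.differentiable] at h1
  simp only [gradient_add hφ.differentiable (hψ.smul (-1)).differentiable,
    gradient_smul hψ.differentiable] at h2
  rw [show (fun x => p + q + (gradient φ x + gradient ψ x)) =
    fun x => p + gradient φ x + (q + gradient ψ x) by ext1 x; abel] at h1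
  rw [show (fun x => p - q + (gradient φ x + (-1 : ℝ) • gradient ψ x)) =
    fun x => p + gradient φ x - (q + gradient ψ x) by
      ext1 x; rw [neg_one_smul]; abel] at h2
  linarith

/-- The reverse inequality is the same one at `p + q` and `p - q`, after homogeneity. -/
theorem mu_parallelogram (a : CoeffField d) {U : Set (E d)}
    (hU : Bornology.IsBounded U) (hUm : MeasurableSet U) (p q : E d) :
    mu a U (p + q) + mu a U (p - q) = 2 * mu a U p + 2 * mu a U q := by
  refine le_antisymm (mu_parallelogram_le a hU hUm p q) ?_
  have h := mu_parallelogram_le a hU hUm (p + q) (p - q)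
  rw [show p + q + (p - q) = (2 : ℝ) • p by rw [two_smul]; abel,
    show p + q - (p - q) = (2 : ℝ) • q by rw [two_smul]; abel, mu_smul a hU hUm,
    mu_smul a hU hUm] at h
  linarith

/-! ### Measurability of the subadditive energy -/

/-- The gradients of test functions form a subset of the separable space `L²`, so this subset has a
dense sequence of its own. -/
theorem exists_seq_isTest_dense (U : Set (E d)) :
    ∃ φ : ℕ → E d → ℝ, (∀ n, IsTest U (φ n)) ∧ ∀ ψ, IsTest U ψ → ∀ ε : ℝ, 0 < ε →
      ∃ n, eLpNorm (fun x => gradient ψ x - gradient (φ n) x) 2 (volume.restrict U) ≤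
        ENNReal.ofReal ε := by
  have : Fact ((2 : ℝ≥0∞) ≠ ⊤) := ⟨by simp⟩
  let g : {φ : E d → ℝ // IsTest U φ} → Lp (E d) 2 (volume.restrict U) := fun φ =>
    (φ.2.memLp_gradient _).toLp (gradient φ.1)
  have : Nonempty {φ : E d → ℝ // IsTest U φ} := ⟨⟨0, IsTest.zero U⟩⟩
  have hex : ∀ n, ∃ φ : {φ : E d → ℝ // IsTest U φ},
      g φ = (TopologicalSpace.denseSeq (Set.range g) n : Lp (E d) 2 (volume.restrict U)) :=
    fun n => (TopologicalSpace.denseSeq (Set.range g) n).2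
  choose φ hφ using hex
  refine ⟨fun n => (φ n).1, fun n => (φ n).2, fun ψ hψ ε hε => ?_⟩
  obtain ⟨n, hn⟩ := (TopologicalSpace.denseRange_denseSeq (Set.range g)).exists_dist_lt
    ⟨g ⟨ψ, hψ⟩, ⟨_, rfl⟩⟩ hε
  refine ⟨n, ?_⟩
  rw [Subtype.dist_eq, ← hφ n, dist_edist] at hn
  simp only [g, Lp.edist_toLp_toLp] at hn
  rw [← ENNReal.ofReal_toReal (a := eLpNorm (fun x => gradient ψ x - gradient (φ n).1 x) 2 _)
    ((hψ.memLp_gradient _).sub ((φ n).2.memLp_gradient _)).eLpNorm_ne_top]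
  exact ENNReal.ofReal_le_ofReal hn.le

/-- One sequence serves every field and slope: each field is bounded on `U`, so density in
unweighted `L²` suffices. -/
theorem exists_seq_mu_eq_iInf {U : Set (E d)} (hU : Bornology.IsBounded U)
    (hUm : MeasurableSet U) :
    ∃ φ : ℕ → E d → ℝ, (∀ n, IsTest U (φ n)) ∧ ∀ (a : CoeffField d) (p : E d),
      mu a U p = ⨅ n, energy a U (fun x => p + gradient (φ n) x) := by
  obtain ⟨φ, hφ, hd⟩ := exists_seq_isTest_dense U
  refine ⟨φ, hφ, fun a p => le_antisymm (le_ciInf fun n => mu_le a p (hφ n)) ?_⟩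
  refine le_mu a hU hUm p fun ψ hψ => le_of_forall_pos_le_add fun η hη => ?_
  obtain ⟨ε, hε, hεb⟩ :=
    exists_energy_le_add a hU hUm (memLp_const_add hU p (hψ.memLp_gradient _)) hη
  obtain ⟨n, hn⟩ := hd ψ hψ ε hε
  refine (ciInf_le ⟨0, ?_⟩ n).trans (hεb _ (memLp_const_add hU p ((hφ n).memLp_gradient _)) ?_)
  · rintro _ ⟨k, rfl⟩
    exact energy_nonneg a U _
  · simpa only [add_sub_add_left_eq_sub] using hn

theorem measurable_integral_entry_mul_test {φ : E d → ℝ} (hφ : IsTest Set.univ φ) (i j : Fin d) :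
    Measurable fun a : CoeffField d => ∫ x, a.toFun x i j * φ x := by
  have h : MeasurableSpace.comap (fun a : CoeffField d => ∫ x, a.toFun x i j * φ x) (borel ℝ) ≤
      instMeasurableSpaceCoeffField d :=
    le_iSup_of_le i (le_iSup_of_le j (le_iSup_of_le φ (le_iSup_of_le hφ le_rfl)))
  exact measurable_iff_comap_le.2 h

/-- An open bounded set is exhausted by test functions. -/
theorem exists_seq_cutoff {U : Set (E d)} (hU : Bornology.IsBounded U) (hUo : IsOpen U) :
    ∃ χ : ℕ → E d → ℝ, (∀ n, ContDiff ℝ ∞ (χ n)) ∧ (∀ n, HasCompactSupport (χ n)) ∧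
      (∀ n x, |χ n x| ≤ U.indicator 1 x) ∧
      ∀ x, Tendsto (fun n => χ n x) atTop (𝓝 (U.indicator 1 x)) := by
  -- `f` is smooth and nonzero exactly on `U`; the transition of `n * f x` vanishes off `U` and
  -- equals `1` once `n ≥ 1 / f x`. Supports lie only in the closure of `U`, so these are test
  -- functions on the whole space.
  obtain ⟨f, hfs, hf, hfr⟩ := hUo.exists_contDiff_support_eq (n := ⊤)
  have hf0 : ∀ x, x ∉ U → f x = 0 := fun x hx => by
    rw [← hfs] at hx
    simpa using hx
  have hfpos : ∀ x ∈ U, 0 < f x := fun x hx => by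
    rw [← hfs] at hx
    exact lt_of_le_of_ne (hfr ⟨x, rfl⟩).1 (Ne.symm hx)
  have hχ0 : ∀ (n : ℕ) x, x ∉ U → Real.smoothTransition (n * f x) = 0 := fun n x hx => by
    simp [hf0 x hx]
  refine ⟨fun n x => Real.smoothTransition (n * f x), fun n => ?_, fun n => ?_, fun n x => ?_,
    fun x => ?_⟩
  · exact Real.smoothTransition.contDiff.comp (contDiff_const.mul hf)
  · refine HasCompactSupport.intro hU.isCompact_closure fun x hx => ?_
    exact hχ0 n x fun h => hx (subset_closure h)
  · by_cases hx : x ∈ U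
    · rw [Set.indicator_of_mem hx, abs_of_nonneg (Real.smoothTransition.nonneg _)]
      exact Real.smoothTransition.le_one _
    · simp [hχ0 n x hx, hx]
  · by_cases hx : x ∈ U
    · rw [Set.indicator_of_mem hx]
      refine tendsto_const_nhds.congr' ?_
      obtain ⟨N, hN⟩ := exists_nat_ge (f x)⁻¹
      filter_upwards [eventually_ge_atTop N] with n hn
      have h1 : (f x)⁻¹ ≤ n := hN.trans (by exact_mod_cast hn)
      rw [Real.smoothTransition.one_of_one_le]
      · rfl
      · rwa [inv_le_iff_one_le_mul₀ (hfpos x hx)] at h1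
    · simp only [hχ0 _ x hx, Set.indicator_of_notMem hx]
      exact tendsto_const_nhds

/-- The generators see only test functions, and `χ n * ψ` tends to `ψ` cut off to `U`; local
boundedness of the field gives dominated convergence. -/
theorem measurable_setIntegral_entry_mul {U : Set (E d)} (hU : Bornology.IsBounded U)
    (hUo : IsOpen U) {ψ : E d → ℝ} (hψ : ContDiff ℝ ∞ ψ) (i j : Fin d) :
    Measurable fun a : CoeffField d => ∫ x in U, a.toFun x i j * ψ x := by
  obtain ⟨χ, hχs, hχc, hχb, hχt⟩ := exists_seq_cutoff hU hUo
  have htest : ∀ n, IsTest Set.univ fun x => χ n x * ψ x := fun n =>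
    ⟨(hχs n).mul hψ, (hχc n).mul_right, Set.subset_univ _⟩
  refine measurable_of_tendsto_metrizable
    (fun n => measurable_integral_entry_mul_test (htest n) i j) ?_
  rw [tendsto_pi_nhds]
  intro a
  obtain ⟨C, hC0, hC⟩ := a.exists_bound hU
  obtain ⟨D, hD⟩ := hU.isCompact_closure.exists_bound_of_continuousOn hψ.continuous.continuousOn
  rw [← integral_indicator hUo.measurableSet]
  refine tendsto_integral_of_dominated_convergence (U.indicator fun _ => C * D) (fun n => ?_)
    ?_ (fun n => ?_) ?_
  · exact ((a.measurable_entry i j).mul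
      ((hχs n).continuous.measurable.mul hψ.continuous.measurable)).aestronglyMeasurable
  · exact (integrable_indicator_iff hUo.measurableSet).2
      (integrableOn_const hU.measure_lt_top.ne)
  · filter_upwards with x
    have h := hχb n x
    by_cases hx : x ∈ U
    · rw [Set.indicator_of_mem hx] at h ⊢
      rw [norm_mul, norm_mul]
      have h1 : ‖a.toFun x i j‖ ≤ C := (abs_entry_le_opNorm _ _ _).trans (hC x hx).1
      have h2 : ‖ψ x‖ ≤ D := hD x (subset_closure hx)
      have h3 : ‖χ n x‖ ≤ 1 := h
      calc ‖a.toFun x i j‖ * (‖χ n x‖ * ‖ψ x‖) ≤ C * (1 * D) := by gcongr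
        _ = C * D := by ring
    · rw [Set.indicator_of_notMem hx] at h ⊢
      have : χ n x = 0 := abs_nonpos_iff.1 h
      simp [this]
  · filter_upwards with x
    have h := ((hχt x).mul_const (ψ x)).const_mul (a.toFun x i j)
    by_cases hx : x ∈ U
    · simpa [hx] using h
    · simpa [hx] using h

theorem measurable_energy {U : Set (E d)} (hU : Bornology.IsBounded U)
    (hUo : IsOpen U) {V : E d → E d} (hV : ContDiff ℝ ∞ V) :
    Measurable fun a : CoeffField d => energy a U V := by
  have hVi : ∀ i, ContDiff ℝ ∞ fun x => V x i := fun i =>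
    (EuclideanSpace.proj (𝕜 := ℝ) i).contDiff.comp hV
  have heq : ∀ a : CoeffField d, energy a U V = (volume.real U)⁻¹ *
      (1 / 2 * ∑ i, ∑ j, ∫ x in U, a.toFun x i j * (V x i * V x j)) := fun a => by
    obtain ⟨C, hC0, hC⟩ := a.exists_bound hU
    have hint : ∀ i j, IntegrableOn (fun x => a.toFun x i j * (V x i * V x j)) U := fun i j => by
      have h2 : IntegrableOn (fun x => V x i * V x j) U :=
        (((hVi i).continuous.mul (hVi j).continuous).continuousOn.integrableOn_compact
          hU.isCompact_closure).mono_set subset_closure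
      refine h2.bdd_mul (c := C) (a.measurable_entry i j).aestronglyMeasurable ?_
      filter_upwards [ae_restrict_mem hUo.measurableSet] with x hx
      exact (abs_entry_le_opNorm _ _ _).trans (hC x hx).1
    rw [energy, setAverage_eq, smul_eq_mul, integral_const_mul]
    simp only [quad_eq_sum]
    rw [integral_finsetSum _ fun i _ => integrable_finsetSum _ fun j _ => hint i j]
    simp_rw [integral_finsetSum Finset.univ fun j _ => hint _ j]
  simp only [heq]
  refine ((Finset.measurable_fun_sum _ fun i _ => Finset.measurable_fun_sum _ fun j _ =>
    ?_).const_mul _).const_mul _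
  exact measurable_setIntegral_entry_mul hU hUo ((hVi i).mul (hVi j)) i j

theorem measurable_mu {U : Set (E d)} (hU : Bornology.IsBounded U)
    (hUo : IsOpen U) (p : E d) : Measurable fun a : CoeffField d => mu a U p := by
  obtain ⟨φ, hφ, h⟩ := exists_seq_mu_eq_iInf hU hUo.measurableSet
  simp only [h]
  exact Measurable.iInf fun n =>
    measurable_energy hU hUo (contDiff_const.add (hφ n).contDiff_gradient)

/-! ### Translations -/

theorem CoeffField.ext_toFun {a b : CoeffField d} (h : a.toFun = b.toFun) : a = b := by
  cases a
  cases b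
  congr

theorem shift_shift_neg (y : E d) (a : CoeffField d) : shift y (shift (-y) a) = a :=
  CoeffField.ext_toFun (by ext1 x; simp [shift])

theorem shift_neg_shift (y : E d) (a : CoeffField d) : shift (-y) (shift y a) = a :=
  CoeffField.ext_toFun (by ext1 x; simp [shift])

/-- Pulling a generator back by a shift translates its test function. -/
theorem measurable_shift (y : E d) : Measurable (shift (d := d) y) := by
  rw [measurable_iff_comap_le]
  change MeasurableSpace.comap (shift y) (sigmaField Set.univ) ≤ _
  simp only [sigmaField, MeasurableSpace.comap_iSup]
  refine iSup_le fun i => iSup_le fun j => iSup_le fun φ => iSup_le fun hφ => ?_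
  rw [MeasurableSpace.comap_comp]
  have h := measurable_integral_entry_mul_test ((hφ.comp_sub y).mono (Set.subset_univ _)) i j
  have he : (fun a : CoeffField d => ∫ x, a.toFun x i j * φ (x - y)) =
      (fun a => ∫ x, a.toFun x i j * φ x) ∘ shift y := by
    ext a
    have := integral_add_right_eq_self (μ := (volume : Measure (E d)))
      (fun x => a.toFun x i j * φ (x - y)) y
    simpa [shift] using this.symm
  exact measurable_iff_comap_le.1 (he ▸ h)

theorem IsStationary.measurePreserving {P : Measure (CoeffField d)} (h : IsStationary P)
    (z : Fin d → ℤ) : MeasurePreserving (shift (latticePoint z)) P P := by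
  refine ⟨measurable_shift _, Measure.ext fun A hA => ?_⟩
  -- Stationarity speaks of images: the image under the shift by `-z` is the preimage under the
  -- shift by `z`.
  rw [Measure.map_apply (measurable_shift _) hA, h (-z) A hA]
  have hz : (latticePoint (-z) : E d) = -latticePoint z := by
    ext i
    simp [latticePoint]
  congr 1
  ext a
  rw [hz, Set.mem_preimage]
  constructor
  · exact fun ha => ⟨_, ha, shift_neg_shift _ a⟩
  · rintro ⟨b, hb, rfl⟩
    rwa [shift_shift_neg]

/-! ### Subadditivity -/

theorem memLp_of_continuous {U : Set (E d)} (hU : Bornology.IsBounded U)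
    (hUm : MeasurableSet U) {V : E d → E d} (hV : Continuous V) :
    MemLp V 2 (volume.restrict U) := by
  have : IsFiniteMeasure (volume.restrict U) := ⟨by simpa using hU.measure_lt_top⟩
  obtain ⟨D, hD⟩ := hU.isCompact_closure.exists_bound_of_continuousOn hV.continuousOn
  refine MemLp.of_bound hV.aestronglyMeasurable D ?_
  filter_upwards [ae_restrict_mem hUm] with x hx
  exact hD x (subset_closure hx)

theorem energy_cube_succ (a : CoeffField d) (m : ℕ) {V : E d → E d} (hV : Continuous V) :
    energy a (cube d (m + 1)) V = ((3 : ℝ) ^ d)⁻¹ * ∑ k : Fin d → Fin 3,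
      energy (shift (subCenter m k) a) (cube d m) (fun x => V (x + subCenter m k)) :=
  setAverage_cube_succ ((integrableOn_quad a (isBounded_cube d _) (measurableSet_cube d _)
    (memLp_of_continuous (isBounded_cube d _) (measurableSet_cube d _) hV)).const_mul (1 / 2))

theorem gradient_sum {ι : Type*} (s : Finset ι) {φ : ι → E d → ℝ}
    (h : ∀ i ∈ s, Differentiable ℝ (φ i)) (x : E d) :
    gradient (∑ i ∈ s, φ i) x = ∑ i ∈ s, gradient (φ i) x := by
  simp only [gradient]
  rw [fderiv_sum fun i hi => h i hi x, map_sum]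

/-- Translated near-minimizers vanish near the boundaries of their subcubes, so their sum is a test
function on the large cube whose gradient on each subcube comes from one summand. -/
theorem mu_cube_succ_le (a : CoeffField d) (m : ℕ) (p : E d) :
    mu a (cube d (m + 1)) p ≤ ((3 : ℝ) ^ d)⁻¹ * ∑ k : Fin d → Fin 3,
      mu (shift (subCenter m k) a) (cube d m) p := by
  have h3 : (0 : ℝ) < 3 ^ d := by positivity
  refine le_of_forall_pos_le_add fun η hη => ?_
  have hex : ∀ k : Fin d → Fin 3, ∃ φ, IsTest (cube d m) φ ∧
      energy (shift (subCenter m k) a) (cube d m) (fun x => p + gradient φ x) <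
        mu (shift (subCenter m k) a) (cube d m) p + η := fun k =>
    exists_energy_lt _ (isBounded_cube d m) (measurableSet_cube d m) p (lt_add_of_pos_right _ hη)
  choose φ hφ hφe using hex
  have htr : ∀ k, IsTest (cube d (m + 1)) fun x => φ k (x - subCenter m k) := fun k =>
    ((hφ k).comp_sub _).mono (subcube_subset m k)
  have htest := IsTest.sum Finset.univ fun k _ => htr k
  have hgrad : ∀ k x, x ∈ cube d m →
      gradient (∑ l, fun x => φ l (x - subCenter m l)) (x + subCenter m k) =
        gradient (φ k) x := fun k x hx => by
    rw [gradient_sum _ fun l _ => (htr l).differentiable, Finset.sum_eq_single k]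
    · rw [gradient_comp_sub, add_sub_cancel_right]
    · intro l _ hl
      rw [gradient_comp_sub]
      by_contra h
      have hmem := (hφ l).tsupport_subset (IsTest.support_gradient_subset _ h)
      exact hl (eq_of_add_subCenter_eq hx hmem (by abel)).symm
    · simp
  refine (mu_le a p htest).trans ?_
  have hcont : Continuous fun x => p + gradient (∑ l, fun x => φ l (x - subCenter m l)) x :=
    continuous_const.add htest.contDiff_gradient.continuous
  rw [energy_cube_succ a m hcont]
  have hsum : ∑ k : Fin d → Fin 3, energy (shift (subCenter m k) a) (cube d m) (fun x =>
      p + gradient (∑ l, fun x => φ l (x - subCenter m l)) (x + subCenter m k)) ≤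
      ∑ k : Fin d → Fin 3, (mu (shift (subCenter m k) a) (cube d m) p + η) := by
    refine Finset.sum_le_sum fun k _ => le_of_eq_of_le ?_ (hφe k).le
    simp only [energy, setAverage_eq]
    congr 1
    refine setIntegral_congr_fun (measurableSet_cube d m) fun x hx => ?_
    simp only [hgrad k x hx]
  calc _ ≤ ((3 : ℝ) ^ d)⁻¹ * ∑ k : Fin d → Fin 3,
        (mu (shift (subCenter m k) a) (cube d m) p + η) := by gcongr
    _ = _ := by
      rw [Finset.sum_add_distrib, mul_add]
      simp

/-! ### Ellipticity bounds -/

theorem quad_eq_norm_sq_mul (A : Matrix (Fin d) (Fin d) ℝ) {ξ : E d} (hξ : ξ ≠ 0) :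
    ∃ η : Metric.sphere (0 : E d) 1, quad A ξ = ‖ξ‖ ^ 2 * quad A η := by
  have h : ‖ξ‖ ≠ 0 := norm_ne_zero_iff.2 hξ
  refine ⟨⟨‖ξ‖⁻¹ • ξ, ?_⟩, ?_⟩
  · simp [norm_smul, h]
  · rw [← quad_smul, smul_inv_smul₀ h]

theorem quad_sphere_le {A : Matrix (Fin d) (Fin d) ℝ} {C : ℝ} (hA : opNorm A ≤ C)
    (η : Metric.sphere (0 : E d) 1) : quad A η ≤ C := by
  have h := (le_abs_self _).trans (abs_quad_le A (η : E d))
  have h1 : ‖(η : E d)‖ = 1 := by simp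
  rw [h1] at h
  linarith

/-- Local boundedness keeps the supremum over the sphere and the essential supremum from falling to
default real values. -/
theorem ae_quad_le_ellipUpper (a : CoeffField d) {U : Set (E d)} (hU : Bornology.IsBounded U)
    (hUm : MeasurableSet U) :
    ∀ᵐ x ∂volume.restrict U, ∀ ξ, quad (a.toFun x) ξ ≤ ellipUpper a U * ‖ξ‖ ^ 2 := by
  obtain ⟨C, hC0, hC⟩ := a.exists_bound hU
  have hb : IsBoundedUnder (· ≤ ·) (ae (volume.restrict U))
      fun x => ⨆ ξ : Metric.sphere (0 : E d) 1, quad (a.toFun x) ξ := by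
    refine ⟨C, eventually_map.2 ?_⟩
    filter_upwards [ae_restrict_mem hUm] with x hx
    exact Real.iSup_le (fun η => quad_sphere_le (hC x hx).1 η) hC0.le
  filter_upwards [ae_le_essSup hb, ae_restrict_mem hUm] with x hx hxU ξ
  rcases eq_or_ne ξ 0 with rfl | hξ
  · simp
  · obtain ⟨η, hη⟩ := quad_eq_norm_sq_mul (a.toFun x) hξ
    rw [hη, mul_comm]
    gcongr
    refine (le_ciSup (f := fun ξ : Metric.sphere (0 : E d) 1 => quad (a.toFun x) ξ) ⟨C, ?_⟩
      η).trans hx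
    rintro _ ⟨ζ, rfl⟩
    exact quad_sphere_le (hC x hxU).1 ζ

theorem ae_ellipLower_le_quad (a : CoeffField d) {U : Set (E d)}
    (hUm : MeasurableSet U) :
    ∀ᵐ x ∂volume.restrict U, ∀ ξ, ellipLower a U * ‖ξ‖ ^ 2 ≤ quad (a.toFun x) ξ := by
  have hb : IsBoundedUnder (· ≥ ·) (ae (volume.restrict U))
      fun x => ⨅ ξ : Metric.sphere (0 : E d) 1, quad (a.toFun x) ξ :=
    ⟨0, eventually_map.2 (Eventually.of_forall fun x =>
      Real.iInf_nonneg fun η => quad_nonneg (a.posDef x) _)⟩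
  filter_upwards [ae_essInf_le hb, ae_restrict_mem hUm] with x hx hxU ξ
  rcases eq_or_ne ξ 0 with rfl | hξ
  · simp
  · obtain ⟨η, hη⟩ := quad_eq_norm_sq_mul (a.toFun x) hξ
    rw [hη, mul_comm]
    gcongr
    refine hx.trans
      (ciInf_le (f := fun ξ : Metric.sphere (0 : E d) 1 => quad (a.toFun x) ξ) ⟨0, ?_⟩ η)
    rintro _ ⟨ζ, rfl⟩
    exact quad_nonneg (a.posDef x) _

/-- A bound `C` on the inverse gives `a ≥ 1/C`. Positive dimension makes the sphere nonempty and
positive volume makes the a.e. filter proper, so the infima are genuine. -/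
theorem ellipLower_pos (hd : 1 ≤ d) (a : CoeffField d) {U : Set (E d)}
    (hU : Bornology.IsBounded U) (hUm : MeasurableSet U) (hU0 : 0 < volume U) :
    0 < ellipLower a U := by
  obtain ⟨C, hC0, hC⟩ := a.exists_bound hU
  have hne : Nonempty (Metric.sphere (0 : E d) 1) :=
    ⟨⟨EuclideanSpace.single ⟨0, hd⟩ 1, by simp⟩⟩
  have : NeBot (ae (volume.restrict U)) := ae_neBot.2 (by simpa using hU0.ne')
  have hb : IsBoundedUnder (· ≤ ·) (ae (volume.restrict U))
      fun x => ⨅ ξ : Metric.sphere (0 : E d) 1, quad (a.toFun x) ξ := by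
    refine ⟨C, eventually_map.2 ?_⟩
    filter_upwards [ae_restrict_mem hUm] with x hx
    refine (ciInf_le ⟨0, ?_⟩ hne.some).trans (quad_sphere_le (hC x hx).1 hne.some)
    rintro _ ⟨ζ, rfl⟩
    exact quad_nonneg (a.posDef x) _
  refine lt_of_lt_of_le (inv_pos.2 hC0) (le_essInf_of_ae_le _ ?_ hb.isCoboundedUnder_ge)
  filter_upwards [ae_restrict_mem hUm] with x hx
  refine le_ciInf fun η => ?_
  have h := norm_sq_le_mul_quad (a.posDef x) hC0 (hC x hx).2 (η : E d)
  have h1 : ‖(η : E d)‖ = 1 := by simp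
  rw [h1] at h
  rw [inv_le_iff_one_le_mul₀ hC0]
  linarith

theorem mu_unit_cube_le (a : CoeffField d) (p : E d) :
    mu a (cube d 0) p ≤ 1 / 2 * (ellipUpper a (cube d 0) * ‖p‖ ^ 2) := by
  refine (mu_le_energy_const a _ p).trans ?_
  have hfin : IsFiniteMeasure (volume.restrict (cube d 0)) :=
    ⟨by simpa using volume_cube_lt_top d 0⟩
  have h : ∫ x in cube d 0, 1 / 2 * quad (a.toFun x) p ≤
      ∫ _ in cube d 0, 1 / 2 * (ellipUpper a (cube d 0) * ‖p‖ ^ 2) := by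
    refine integral_mono_ae ((integrableOn_quad a (isBounded_cube d 0) (measurableSet_cube d 0)
      (memLp_const p)).const_mul _) (integrable_const _) ?_
    filter_upwards [ae_quad_le_ellipUpper a (isBounded_cube d 0) (measurableSet_cube d 0)] with x hx
    have := hx p
    linarith
  simpa [energy, setAverage_eq, volume_real_cube] using h

/-! ### The lower bound -/

/-- The mean of a functional over the unit cubes which make up `cube d m`. -/
def triadicMean (X : CoeffField d → ℝ) : ℕ → CoeffField d → ℝ
  | 0 => X
  | m + 1 => fun a => ((3 : ℝ) ^ d)⁻¹ * ∑ k : Fin d → Fin 3,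
      triadicMean X m (shift (subCenter m k) a)

/-- Young's inequality in a form linear in `V`, so that it can be averaged over cubes; `s` is free.
-/
theorem le_energy_unit_cube (hd : 1 ≤ d) (a : CoeffField d) (p : E d) (s : ℝ) {V : E d → E d}
    (hV : Continuous V) :
    s * (⨍ x in cube d 0, inner ℝ p (V x)) -
      s ^ 2 / 2 * ‖p‖ ^ 2 * (ellipLower a (cube d 0))⁻¹ ≤ energy a (cube d 0) V := by
  have hfin : IsFiniteMeasure (volume.restrict (cube d 0)) :=
    ⟨by simpa using volume_cube_lt_top d 0⟩
  have hl := ellipLower_pos hd a (isBounded_cube d 0) (measurableSet_cube d 0)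
    (volume_cube_pos d 0)
  have hLp := memLp_of_continuous (isBounded_cube d 0) (measurableSet_cube d 0) hV
  have hi : IntegrableOn (fun x => inner ℝ p (V x)) (cube d 0) :=
    ((continuous_const.inner hV).continuousOn.integrableOn_compact
      (isBounded_cube d 0).isCompact_closure).mono_set subset_closure
  have h : ∫ x in cube d 0,
      (s * inner ℝ p (V x) - s ^ 2 / 2 * ‖p‖ ^ 2 * (ellipLower a (cube d 0))⁻¹) ≤
      ∫ x in cube d 0, 1 / 2 * quad (a.toFun x) (V x) := by
    refine integral_mono_ae ((hi.const_mul s).sub (integrable_const _))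
      ((integrableOn_quad a (isBounded_cube d 0) (measurableSet_cube d 0) hLp).const_mul _) ?_
    filter_upwards [ae_ellipLower_le_quad a (measurableSet_cube d 0)] with x hx
    have h1 := hx (V x)
    set l := ellipLower a (cube d 0)
    -- Twice the pointwise Young defect for the form `l|V|²/2`, as a completed square.
    have h2 : 0 ≤ l⁻¹ * ‖l • V x - s • p‖ ^ 2 := by positivity
    rw [norm_sub_sq_real, norm_smul, norm_smul, inner_smul_left, inner_smul_right, mul_pow,
      mul_pow, Real.norm_eq_abs, Real.norm_eq_abs, sq_abs, sq_abs, real_inner_comm] at h2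
    have h3 : l⁻¹ * (l ^ 2 * ‖V x‖ ^ 2 -
        2 * ((starRingEnd ℝ) l * (s * inner ℝ p (V x))) + s ^ 2 * ‖p‖ ^ 2) =
        l * ‖V x‖ ^ 2 - 2 * (s * inner ℝ p (V x)) + s ^ 2 * ‖p‖ ^ 2 * l⁻¹ := by
      rw [conj_trivial]
      field_simp
    rw [h3] at h2
    linarith
  rw [integral_sub (hi.const_mul s) (integrable_const _), integral_const_mul] at h
  simpa only [energy, setAverage_eq, volume_real_cube, pow_zero, one_pow, inv_one, one_smul,
    integral_const, measureReal_restrict_apply_univ] using h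

/-- All three terms average exactly over subcubes, so the bound passes up the scales; the field
varies in the induction because subcubes see shifted fields. -/
theorem le_energy_cube (hd : 1 ≤ d) (p : E d) (s : ℝ) (m : ℕ) (a : CoeffField d) {V : E d → E d}
    (hV : Continuous V) :
    s * (⨍ x in cube d m, inner ℝ p (V x)) - s ^ 2 / 2 * ‖p‖ ^ 2 *
      triadicMean (fun a => (ellipLower a (cube d 0))⁻¹) m a ≤ energy a (cube d m) V := by
  induction m generalizing a V with
  | zero => exact le_energy_unit_cube hd a p s hV
  | succ m ih =>
    have hi : IntegrableOn (fun x => inner ℝ p (V x)) (cube d (m + 1)) :=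
      ((continuous_const.inner hV).continuousOn.integrableOn_compact
        (isBounded_cube d _).isCompact_closure).mono_set subset_closure
    rw [energy_cube_succ a m hV, setAverage_cube_succ hi, triadicMean, mul_left_comm,
      mul_left_comm (s ^ 2 / 2 * ‖p‖ ^ 2), ← mul_sub, Finset.mul_sum, Finset.mul_sum,
      ← Finset.sum_sub_distrib]
    refine mul_le_mul_of_nonneg_left (Finset.sum_le_sum fun k _ => ?_) (by positivity)
    exact ih (shift (subCenter m k) a) (hV.comp (continuous_id.add continuous_const))

theorem average_inner_add_gradient (m : ℕ) (p : E d) {φ : E d → ℝ} (hφ : IsTest (cube d m) φ) :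
    ⨍ x in cube d m, inner ℝ p (p + gradient φ x) = ‖p‖ ^ 2 := by
  have hfin : IsFiniteMeasure (volume.restrict (cube d m)) :=
    ⟨by simpa using volume_cube_lt_top d m⟩
  have hg : ∀ i, Integrable (fun x => gradient φ x i) (volume.restrict (cube d m)) := fun i =>
    ((EuclideanSpace.proj (𝕜 := ℝ) i).continuous.comp
      hφ.contDiff_gradient.continuous).integrable_of_hasCompactSupport
      (hφ.hasCompactSupport_gradient.comp_left (g := fun v : E d => v i) rfl)
  have hexp : ∀ x, inner ℝ p (p + gradient φ x) = ‖p‖ ^ 2 + ∑ i, p i * gradient φ x i := fun x => by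
    rw [inner_add_right, real_inner_self_eq_norm_sq, PiLp.inner_apply]
    congr 1
    exact Finset.sum_congr rfl fun i _ => by simp [mul_comm]
  have hv : volume.real (cube d m) ≠ 0 := by
    rw [volume_real_cube]
    positivity
  simp only [hexp, setAverage_eq, smul_eq_mul]
  rw [integral_add (integrable_const _) (integrable_finsetSum _ fun i _ => (hg i).const_mul _),
    integral_finsetSum _ fun i _ => (hg i).const_mul _]
  simp only [integral_const_mul, integral_gradient_eq_zero hφ, mul_zero, Finset.sum_const_zero,
    add_zero]
  simp [hv]

theorem le_mu_cube (hd : 1 ≤ d) (p : E d) (s : ℝ) (m : ℕ) (a : CoeffField d) :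
    s * ‖p‖ ^ 2 - s ^ 2 / 2 * ‖p‖ ^ 2 *
      triadicMean (fun a => (ellipLower a (cube d 0))⁻¹) m a ≤ mu a (cube d m) p := by
  refine le_mu a (isBounded_cube d m) (measurableSet_cube d m) p fun φ hφ => ?_
  have hcont : Continuous fun x => p + gradient φ x :=
    continuous_const.add hφ.contDiff_gradient.continuous
  have h := le_energy_cube hd p s m a hcont
  rwa [average_inner_add_gradient m p hφ] at h

/-! ### Expectations -/

/-- Integer stationarity suffices because `3 ^ m` is an integer. -/
theorem IsStationary.measurePreserving_subCenter {P : Measure (CoeffField d)}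
    (hstat : IsStationary P) (m : ℕ) (k : Fin d → Fin 3) :
    MeasurePreserving (shift (subCenter m k)) P P :=
  hstat.measurePreserving (subIndex m k)

theorem integral_mean_shift {P : Measure (CoeffField d)} (hstat : IsStationary P) (m : ℕ)
    {X : CoeffField d → ℝ} (hX : Integrable X P) :
    Integrable (fun a => ((3 : ℝ) ^ d)⁻¹ * ∑ k : Fin d → Fin 3, X (shift (subCenter m k) a)) P ∧
      ∫ a, ((3 : ℝ) ^ d)⁻¹ * ∑ k : Fin d → Fin 3, X (shift (subCenter m k) a) ∂P =
        ∫ a, X a ∂P := by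
  have hi : ∀ k, Integrable (fun a => X (shift (subCenter m k) a)) P := fun k =>
    (hstat.measurePreserving_subCenter m k).integrable_comp_of_integrable hX
  refine ⟨(integrable_finsetSum _ fun k _ => hi k).const_mul _, ?_⟩
  rw [integral_const_mul, integral_finsetSum _ fun k _ => hi k]
  have he : ∀ k : Fin d → Fin 3, ∫ a, X (shift (subCenter m k) a) ∂P = ∫ a, X a ∂P := fun k => by
    have hmp := hstat.measurePreserving_subCenter m k
    have h := integral_map (μ := P) hmp.measurable.aemeasurable (f := X)
      (by rw [hmp.map_eq]; exact hX.1)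
    rw [hmp.map_eq] at h
    exact h.symm
  simp [he]

theorem integrable_triadicMean {P : Measure (CoeffField d)} (hstat : IsStationary P)
    {X : CoeffField d → ℝ} (hX : Integrable X P) (m : ℕ) :
    Integrable (triadicMean X m) P ∧ ∫ a, triadicMean X m a ∂P = ∫ a, X a ∂P := by
  induction m with
  | zero => exact ⟨hX, rfl⟩
  | succ m ih =>
    obtain ⟨h1, h2⟩ := integral_mean_shift hstat m ih.1
    exact ⟨h1, h2.trans ih.2⟩

/-- Domination by `Λ` on the unit cube, then by the shifted averages of the previous scale. -/
theorem integrable_mu_cube {P : Measure (CoeffField d)} (hstat : IsStationary P)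
    (hΛ : Integrable (fun a => ellipUpper a (cube d 0)) P) (m : ℕ)
    (p : E d) : Integrable (fun a => mu a (cube d m) p) P := by
  have hmeas : ∀ m, AEStronglyMeasurable (fun a => mu a (cube d m) p) P := fun m =>
    (measurable_mu (isBounded_cube d m) (isOpen_cube d m) p).aestronglyMeasurable
  induction m with
  | zero =>
    refine ((hΛ.mul_const (‖p‖ ^ 2)).const_mul (1 / 2)).mono' (hmeas 0) ?_
    filter_upwards with a
    rw [Real.norm_of_nonneg (mu_nonneg _ _ _)]
    exact mu_unit_cube_le a p
  | succ m ih =>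
    refine (integral_mean_shift hstat m ih).1.mono' (hmeas (m + 1)) ?_
    filter_upwards with a
    rw [Real.norm_of_nonneg (mu_nonneg _ _ _)]
    exact mu_cube_succ_le a m p

theorem antitone_meanMu {P : Measure (CoeffField d)} (hstat : IsStationary P)
    (hΛ : Integrable (fun a => ellipUpper a (cube d 0)) P) (p : E d) :
    Antitone fun m => meanMu P m p := by
  refine antitone_nat_of_succ_le fun m => ?_
  obtain ⟨h1, h2⟩ := integral_mean_shift hstat m (integrable_mu_cube hstat hΛ m p)
  rw [meanMu, meanMu, ← h2]
  exact integral_mono (integrable_mu_cube hstat hΛ (m + 1) p) h1 fun a => mu_cube_succ_le a m p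

theorem meanMu_nonneg {P : Measure (CoeffField d)} (m : ℕ) (p : E d) : 0 ≤ meanMu P m p :=
  integral_nonneg fun a => mu_nonneg a _ p

theorem tendsto_meanMu {P : Measure (CoeffField d)} (hstat : IsStationary P)
    (hΛ : Integrable (fun a => ellipUpper a (cube d 0)) P) (p : E d) :
    Tendsto (fun m => meanMu P m p) atTop (𝓝 (⨅ m, meanMu P m p)) := by
  refine tendsto_atTop_ciInf (antitone_meanMu hstat hΛ p) ⟨0, ?_⟩
  rintro _ ⟨m, rfl⟩
  exact meanMu_nonneg m p

theorem meanMu_le {P : Measure (CoeffField d)} (hstat : IsStationary P)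
    (hΛ : Integrable (fun a => ellipUpper a (cube d 0)) P) (m : ℕ) (p : E d) :
    meanMu P m p ≤ 1 / 2 * ((∫ a, ellipUpper a (cube d 0) ∂P) * ‖p‖ ^ 2) := by
  refine (antitone_meanMu hstat hΛ p (Nat.zero_le m)).trans ?_
  rw [← integral_mul_const, ← integral_const_mul]
  exact integral_mono (integrable_mu_cube hstat hΛ 0 p) ((hΛ.mul_const _).const_mul _)
    fun a => mu_unit_cube_le a p

theorem le_meanMu {P : Measure (CoeffField d)} (hstat : IsStationary P) [IsProbabilityMeasure P]
    (hd : 1 ≤ d)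
    (hΛ : Integrable (fun a => ellipUpper a (cube d 0)) P)
    (hlam : Integrable (fun a => (ellipLower a (cube d 0))⁻¹) P) (s : ℝ) (m : ℕ) (p : E d) :
    s * ‖p‖ ^ 2 - s ^ 2 / 2 * ‖p‖ ^ 2 * ∫ a, (ellipLower a (cube d 0))⁻¹ ∂P ≤ meanMu P m p := by
  obtain ⟨h1, h2⟩ := integrable_triadicMean hstat hlam m
  have h := integral_mono ((integrable_const (s * ‖p‖ ^ 2)).sub
    (h1.const_mul (s ^ 2 / 2 * ‖p‖ ^ 2))) (integrable_mu_cube hstat hΛ m p)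
    fun a => le_mu_cube hd p s m a
  simp only [Pi.sub_apply] at h
  rw [integral_sub (integrable_const _) (h1.const_mul _),
    integral_const_mul (s ^ 2 / 2 * ‖p‖ ^ 2), h2, integral_const] at h
  simpa only [meanMu, probReal_univ, one_smul] using h

/-! ### The homogenized matrix -/

theorem meanMu_smul {P : Measure (CoeffField d)} (m : ℕ) (t : ℝ) (p : E d) : meanMu P m
    (t • p) = t ^ 2 * meanMu P m p := by
  simp only [meanMu, mu_smul _ (isBounded_cube d m) (measurableSet_cube d m), integral_const_mul]

theorem meanMu_parallelogram {P : Measure (CoeffField d)} (hstat : IsStationary P)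
    (hΛ : Integrable (fun a => ellipUpper a (cube d 0)) P) (m : ℕ)
    (p q : E d) :
    meanMu P m (p + q) + meanMu P m (p - q) = 2 * meanMu P m p + 2 * meanMu P m q := by
  have hi := integrable_mu_cube hstat hΛ m
  simp only [meanMu]
  rw [← integral_add (hi _) (hi _), ← integral_const_mul, ← integral_const_mul,
    ← integral_add ((hi _).const_mul 2) ((hi _).const_mul 2)]
  simp only [mu_parallelogram _ (isBounded_cube d m) (measurableSet_cube d m)]

theorem exists_isHomogenizedMatrix {P : Measure (CoeffField d)} (hstat : IsStationary P)
    (hΛ : Integrable (fun a => ellipUpper a (cube d 0)) P) :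
    ∃ abar : Matrix (Fin d) (Fin d) ℝ, IsHomogenizedMatrix P abar := by
  -- The matrix represents `2 * Q`, because of the factor `1 / 2` in the energy.
  let Q : E d → ℝ := fun p => ⨅ m, meanMu P m p
  have ht : ∀ p, Tendsto (fun m => meanMu P m p) atTop (𝓝 (Q p)) := tendsto_meanMu hstat hΛ
  have hsmul : ∀ (t : ℝ) p, 2 * Q (t • p) = t ^ 2 * (2 * Q p) := fun t p => by
    have h := tendsto_nhds_unique (ht (t • p))
      (((ht p).const_mul (t ^ 2)).congr fun m => (meanMu_smul m t p).symm)
    rw [h]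
    ring
  have hpar : ∀ p q, 2 * Q (p + q) + 2 * Q (p - q) = 2 * (2 * Q p) + 2 * (2 * Q q) :=
    fun p q => by
      have h := tendsto_nhds_unique ((ht (p + q)).add (ht (p - q)))
        ((((ht p).const_mul 2).add ((ht q).const_mul 2)).congr fun m =>
          (meanMu_parallelogram hstat hΛ m p q).symm)
      linarith
  have hbd : ∀ p, |2 * Q p| ≤ (∫ a, ellipUpper a (cube d 0) ∂P) * ‖p‖ ^ 2 := fun p => by
    have h0 : 0 ≤ Q p := ge_of_tendsto' (ht p) fun m => meanMu_nonneg m p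
    have h1 := le_of_tendsto' (ht p) fun m => meanMu_le hstat hΛ m p
    rw [abs_of_nonneg (by linarith)]
    linarith
  obtain ⟨A, hA, hAQ⟩ := exists_symm_matrix_of_parallelogram (fun p => 2 * Q p) hsmul hpar hbd
  refine ⟨A, hA, fun p => ?_⟩
  rw [hAQ]
  simpa using ht p

theorem IsHomogenizedMatrix.unique {P : Measure (CoeffField d)} {A B : Matrix (Fin d) (Fin d) ℝ}
    (hA : IsHomogenizedMatrix P A) (hB : IsHomogenizedMatrix P B) : A = B :=
  ext_of_quad_eq hA.1 hB.1 fun p => by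
    linarith [tendsto_nhds_unique (hA.2 p) (hB.2 p)]

theorem integral_inv_ellipLower_pos {P : Measure (CoeffField d)} [IsProbabilityMeasure P]
    (hd : 1 ≤ d) (hlam : Integrable (fun a => (ellipLower a (cube d 0))⁻¹) P) :
    0 < ∫ a, (ellipLower a (cube d 0))⁻¹ ∂P := by
  have hpos : ∀ a : CoeffField d, 0 < (ellipLower a (cube d 0))⁻¹ := fun a =>
    inv_pos.2 (ellipLower_pos hd a (isBounded_cube d 0) (measurableSet_cube d 0)
      (volume_cube_pos d 0))
  rw [integral_pos_iff_support_of_nonneg (fun a => (hpos a).le) hlam]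
  have : (Function.support fun a : CoeffField d => (ellipLower a (cube d 0))⁻¹) = Set.univ :=
    Set.eq_univ_of_forall fun a => (hpos a).ne'
  simp [this]

theorem quad_sub (A B : Matrix (Fin d) (Fin d) ℝ) (p : E d) :
    quad (A - B) p = quad A p - quad B p := by
  simp only [quad, Matrix.sub_mulVec, dotProduct_sub]

theorem quad_smul_one (c : ℝ) (p : E d) :
    quad (c • (1 : Matrix (Fin d) (Fin d) ℝ)) p = c * ‖p‖ ^ 2 := by
  rw [quad_eq_inner]
  simp [matCLM, inner_smul_right]

end StochHom

end

open StochHom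

theorem proposition2p4 (d : ℕ) (hd : 1 ≤ d)
    (P : Measure (StochHom.CoeffField d)) [IsProbabilityMeasure P]
    (hstat : StochHom.IsStationary P)
    (r : ℝ) (hr0 : 0 < r) (hr1 : r < 1) (hmix : StochHom.MaxCorrelationLE P r)
    (hΛ : Integrable (fun a => StochHom.ellipUpper a (StochHom.cube d 0)) P)
    (hlam : Integrable (fun a => (StochHom.ellipLower a (StochHom.cube d 0))⁻¹) P) :
    (∀ (m : ℕ) (p : StochHom.E d),
      Integrable (fun a => StochHom.mu a (StochHom.cube d m) p) P) ∧
    (∀ p : StochHom.E d,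
      Tendsto (fun m => StochHom.meanMu P m p) atTop (𝓝 (⨅ m, StochHom.meanMu P m p))) ∧
    (∃! abar : Matrix (Fin d) (Fin d) ℝ, StochHom.IsHomogenizedMatrix P abar) ∧
    (∀ abar : Matrix (Fin d) (Fin d) ℝ, StochHom.IsHomogenizedMatrix P abar →
      abar.PosDef ∧
      StochHom.LoewnerLE
        ((∫ a, (StochHom.ellipLower a (StochHom.cube d 0))⁻¹ ∂P)⁻¹ •
          (1 : Matrix (Fin d) (Fin d) ℝ)) abar ∧
      StochHom.LoewnerLE abar
        ((∫ a, StochHom.ellipUpper a (StochHom.cube d 0) ∂P) •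
          (1 : Matrix (Fin d) (Fin d) ℝ))) := by
  obtain ⟨A, hA⟩ := exists_isHomogenizedMatrix hstat hΛ
  refine ⟨integrable_mu_cube hstat hΛ, tendsto_meanMu hstat hΛ,
    ⟨A, hA, fun B hB => hB.unique hA⟩, fun B hB => ?_⟩
  have hL := integral_inv_ellipLower_pos hd hlam
  have hlow : ∀ p : E d, (∫ a, (ellipLower a (cube d 0))⁻¹ ∂P)⁻¹ * ‖p‖ ^ 2 ≤ quad B p := by
    intro p
    -- With `L = E[λ⁻¹]`, the coefficient `s - s² L / 2` is largest at `s = L⁻¹`, where it equals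
    -- `L⁻¹ / 2`.
    have h := ge_of_tendsto' (hB.2 p) fun m =>
      le_meanMu hstat hd hΛ hlam (∫ a, (ellipLower a (cube d 0))⁻¹ ∂P)⁻¹ m p
    set L := ∫ a, (ellipLower a (cube d 0))⁻¹ ∂P
    have h1 : L⁻¹ * ‖p‖ ^ 2 - L⁻¹ ^ 2 / 2 * ‖p‖ ^ 2 * L = 1 / 2 * (L⁻¹ * ‖p‖ ^ 2) := by
      field_simp
      ring
    linarith
  refine ⟨Matrix.PosDef.of_dotProduct_mulVec_pos (by simpa using hB.1) fun x hx => ?_,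
    fun p => ?_, fun p => ?_⟩
  · have hx' : (WithLp.toLp 2 x : E d) ≠ 0 := by simpa using hx
    have h := hlow (WithLp.toLp 2 x)
    have h1 : 0 < ‖(WithLp.toLp 2 x : E d)‖ := norm_pos_iff.2 hx'
    have h2 : 0 < quad B (WithLp.toLp 2 x) := lt_of_lt_of_le (by positivity) h
    simpa [quad] using h2
  · rw [quad_sub, quad_smul_one]
    linarith [hlow p]
  · have h := le_of_tendsto' (hB.2 p) fun m => meanMu_le hstat hΛ m p
    rw [quad_sub, quad_smul_one]
    linarith
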